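/- For a finite simple graph $G$, let $\gamma(G)$ be its domination number, that is, the minimum size of a set $D\subseteq V(G)$ such that every vertex outside $D$ has a neighbor in $D$. The dominating set problem for a class $\mathcal X$ of graphs is to decide, for given $G\in\mathcal X$ and $k\in\mathbb N$, whether $\gamma(G)\le k$. Let $P_5$ be the path with five vertices, let $fork$ be the graph obtained from the star $K_{1,3}$ by subdividing one edge, and let $K_3+K_2$ be the disjoint union of a triangle and an edge. A graph is $\mathcal Y$-free if it has no induced subgraph isomorphic to a graph in $\mathcal Y$. Then the dominating set problem for $\{fork,K_3+K_2\}$-free graphs can be polynomially reduced to the same problem for $\{P_5,fork,K_3+K_2\}$-free graphs. That is, there is an algorithm which, given a $\{fork,K_3+K_2\}$-free graph $G$ (by its adjacency matrix) and a number $k\in\mathbb N$, outputs within a number of steps of a random access machine (with unit-cost addition, truncated subtraction and indirect memory access) that is bounded by a polynomial in $|V(G)|$ a $\{P_5,fork,K_3+K_2\}$-free graph $G'$, whose number of vertices is also bounded by a polynomial in $|V(G)|$, and a number $k'\in\mathbb N$, such that $\gamma(G)\le k$ if and only if $\gamma(G')\le k'$. -/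

import Mathlib

open scoped SimpleGraph

/-! ### Domination -/

/-- `D` is a dominating set of `G`: each vertex outside `D` has a neighbor in `D`. -/
def IsDominatingSet {V : Type} (G : SimpleGraph V) (D : Finset V) : Prop :=
  ∀ v, v ∉ D → ∃ u ∈ D, G.Adj v u

/-- The domination number of a graph with finitely many vertices: the least size of a dominating
set (the set of all vertices is dominating, so the infimum is attained). -/
noncomputable def dominationNumber {n : ℕ} (G : SimpleGraph (Fin n)) : ℕ :=
  sInf {m | ∃ D : Finset (Fin n), IsDominatingSet G D ∧ D.card = m}

/-! ### Graph classes given by forbidden induced subgraphs -/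

/-- The fork: the claw with center `0` and leaves `1, 2, 3`, whose edge `03` has been subdivided,
that is, the edges are `01`, `02`, `03`, `34`. -/
def forkGraph : SimpleGraph (Fin 5) :=
  SimpleGraph.fromEdgeSet {s(0, 1), s(0, 2), s(0, 3), s(3, 4)}

/-- The disjoint union of a triangle and an edge. -/
def triangleAddEdge : SimpleGraph (Fin 3 ⊕ Fin 2) :=
  (⊤ : SimpleGraph (Fin 3)) ⊕g (⊤ : SimpleGraph (Fin 2))

/-- A class of finite simple graphs, on the vertex sets `{0, …, n - 1}`. -/
abbrev GraphClass : Type := ∀ n : ℕ, Set (SimpleGraph (Fin n))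

/-- The class of `{fork, K₃ + K₂}`-free graphs. -/
def freeForkK3K2 : GraphClass := fun _ =>
  {G | ¬ forkGraph ⊴ G ∧ ¬ triangleAddEdge ⊴ G}

/-- The class of `{P₅, fork, K₃ + K₂}`-free graphs. -/
def freeP5ForkK3K2 : GraphClass := fun _ =>
  {G | ¬ SimpleGraph.pathGraph 5 ⊴ G ∧ ¬ forkGraph ⊴ G ∧ ¬ triangleAddEdge ⊴ G}

/-! ### Random access machines with a step count

The machine has registers and a memory, both holding natural numbers. A program uses finitely many
fixed registers and addresses the memory indirectly. Each elementary instruction and each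
evaluation of a branching condition costs one step. As there is no multiplication, a value grows
by at most one bit in each step, so that polynomial time on this machine is the usual notion. -/

/-- Programs. Registers are named by natural numbers that are fixed in the program text. -/
inductive RamProgram : Type
  /-- do nothing -/
  | skip : RamProgram
  /-- `set d c`: put the constant `c` into register `d` -/
  | set (d c : ℕ) : RamProgram
  /-- `add d a b`: put the sum of registers `a` and `b` into register `d` -/
  | add (d a b : ℕ) : RamProgram
  /-- `sub d a b`: put the truncated difference of registers `a` and `b` into register `d` -/
  | sub (d a b : ℕ) : RamProgram
  /-- `load d a`: put the content of the memory cell addressed by register `a` into register `d` -/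
  | load (d a : ℕ) : RamProgram
  /-- `store a b`: put register `b` into the memory cell addressed by register `a` -/
  | store (a b : ℕ) : RamProgram
  /-- run the first program, then the second one -/
  | seq (P Q : RamProgram) : RamProgram
  /-- `ite a P Q`: run `P` if register `a` is nonzero, and `Q` otherwise -/
  | ite (a : ℕ) (P Q : RamProgram) : RamProgram
  /-- `loop a P`: while register `a` is nonzero, run `P` -/
  | loop (a : ℕ) (P : RamProgram) : RamProgram

/-- A state of the machine: the contents of the registers and of the memory cells. -/
structure RamState : Type where
  /-- registers -/
  reg : ℕ → ℕ
  /-- memory -/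
  mem : ℕ → ℕ

/-- Overwrite register `d` with the value `v`. -/
def RamState.setReg (s : RamState) (d v : ℕ) : RamState :=
  ⟨Function.update s.reg d v, s.mem⟩

/-- Overwrite memory cell `d` with the value `v`. -/
def RamState.setMem (s : RamState) (d v : ℕ) : RamState :=
  ⟨s.reg, Function.update s.mem d v⟩

/-- `RamRun P s s' t`: the program `P`, started in the state `s`, halts in the state `s'` after
exactly `t` steps. -/
inductive RamRun : RamProgram → RamState → RamState → ℕ → Prop
  | skip (s : RamState) : RamRun .skip s s 1
  | set (d c : ℕ) (s : RamState) : RamRun (.set d c) s (s.setReg d c) 1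
  | add (d a b : ℕ) (s : RamState) :
      RamRun (.add d a b) s (s.setReg d (s.reg a + s.reg b)) 1
  | sub (d a b : ℕ) (s : RamState) :
      RamRun (.sub d a b) s (s.setReg d (s.reg a - s.reg b)) 1
  | load (d a : ℕ) (s : RamState) :
      RamRun (.load d a) s (s.setReg d (s.mem (s.reg a))) 1
  | store (a b : ℕ) (s : RamState) :
      RamRun (.store a b) s (s.setMem (s.reg a) (s.reg b)) 1
  | seq {P Q : RamProgram} {s s' s'' : RamState} {t t' : ℕ}
      (hP : RamRun P s s' t) (hQ : RamRun Q s' s'' t') :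
      RamRun (.seq P Q) s s'' (t + t')
  | ite_true {a : ℕ} {P Q : RamProgram} {s s' : RamState} {t : ℕ}
      (ha : s.reg a ≠ 0) (hP : RamRun P s s' t) :
      RamRun (.ite a P Q) s s' (t + 1)
  | ite_false {a : ℕ} {P Q : RamProgram} {s s' : RamState} {t : ℕ}
      (ha : s.reg a = 0) (hQ : RamRun Q s s' t) :
      RamRun (.ite a P Q) s s' (t + 1)
  | loop_done {a : ℕ} {P : RamProgram} {s : RamState}
      (ha : s.reg a = 0) :
      RamRun (.loop a P) s s 1
  | loop_step {a : ℕ} {P : RamProgram} {s s' s'' : RamState} {t t' : ℕ}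
      (ha : s.reg a ≠ 0) (hP : RamRun P s s' t) (hl : RamRun (.loop a P) s' s'' t') :
      RamRun (.loop a P) s s'' (t + t' + 1)

/-! ### Instances of the dominating set problem as inputs and outputs -/

open Classical in
/-- The initial state for the instance `(G, k)`: register `0` holds the number `n` of vertices,
register `1` holds `k`, the memory cells `0, …, n * n - 1` hold the adjacency matrix of `G` row by
row, and everything else is zero. -/
noncomputable def inputState {n : ℕ} (G : SimpleGraph (Fin n)) (k : ℕ) : RamState where
  reg a := if a = 0 then n else if a = 1 then k else 0
  mem a := if ∃ i j : Fin n, a = (i : ℕ) * n + (j : ℕ) ∧ G.Adj i j then 1 else 0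

/-- In the state `s` the instance `(G, k)` is written, in the same format as for inputs; registers
and memory cells outside it may hold anything. -/
def IsOutputState {n : ℕ} (s : RamState) (G : SimpleGraph (Fin n)) (k : ℕ) : Prop :=
  s.reg 0 = n ∧ s.reg 1 = k ∧
    ∀ i j : Fin n, (G.Adj i j → s.mem ((i : ℕ) * n + (j : ℕ)) = 1) ∧
      (¬ G.Adj i j → s.mem ((i : ℕ) * n + (j : ℕ)) = 0)

/-- The dominating set problem for graphs in `X` polynomially reduces to the same problem for
graphs in `Y`: some program transforms every instance `(G, k)` with `G ∈ X` into an instance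
`(G', k')` with `G' ∈ Y` and the same answer to "is the domination number at most the given
number?", such that both its running time and the number of vertices of `G'` are bounded by a
polynomial in the number of vertices of `G`. -/
def DominatingSetPolyReducible (X Y : GraphClass) : Prop :=
  ∃ (P : RamProgram) (p : Polynomial ℕ),
    ∀ (n : ℕ) (G : SimpleGraph (Fin n)), G ∈ X n → ∀ k : ℕ,
      ∃ (s : RamState) (t : ℕ), RamRun P (inputState G k) s t ∧ t ≤ p.eval n ∧
        ∃ (n' : ℕ) (G' : SimpleGraph (Fin n')) (k' : ℕ), IsOutputState s G' k' ∧
          n' ≤ p.eval n ∧ G' ∈ Y n' ∧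
          (dominationNumber G ≤ k ↔ dominationNumber G' ≤ k')

/-! ### Induced forks and triangles with an edge -/

section GraphTheory

variable {V : Type} {G : SimpleGraph V}

/-! The problem on the larger class is itself solvable in polynomial time, so a reduction can
compute $\gamma(G)$ and output a one-vertex graph with the bound $k'=(k+1)-\gamma(G)$. The number
$k$ enters only one addition and one subtraction, so the running time depends on $n$ alone.

The domination number is the sum over the components. A component of maximum degree at most two has
a Hamiltonian path, and its domination number is a third of its order, rounded up. For every other
component the point is `HasCore`: some set $A$ of at most 15 vertices, together with the vertices
that it leaves undominated, is a minimum dominating set. Such a completion always dominates, so the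
minimum over all 15-tuples is exact, and there are only $n^{15}$ tuples.

To find a core, suppose first that there is no triangle. Forks at a vertex $v$ of degree at least
three then force four vertices to dominate everything (`hasCore_of_triangleFree`). Otherwise fix a
triangle $T$. The vertices $I$ without neighbors in $T$ are independent, since $K_3+K_2$ is
excluded. Let $D\subseteq N(T)$ be a smallest set dominating $I$. If $D$ is small, $T\cup D$ is a
bounded dominating set. If $D$ is large, excluding forks and $K_3+K_2$ makes $D$ a clique with
private neighbors in $I$, and `hasCore_of_corona` shows that any three vertices of $D$ form a core,
by exhibiting a packing of the same size as their completion.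

For the machine, `RamTerm` is a small language of terms with sums over $0,\dots,n-1$ that compiles
to programs of polynomial cost. Once the reachability matrix is in memory, $\gamma(G)$ is the value
of one fixed term. -/

lemma nadj_symm {a b : V} (h : ¬ G.Adj a b) : ¬ G.Adj b a := fun h' => h h'.symm

lemma not_fork (hF : ¬ forkGraph ⊴ G) {c x y z w : V} (hxy : x ≠ y)
    (hcx : G.Adj c x) (hcy : G.Adj c y) (hcz : G.Adj c z) (hzw : G.Adj z w)
    (nxy : ¬ G.Adj x y) (nxz : ¬ G.Adj x z) (nyz : ¬ G.Adj y z)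
    (nwc : ¬ G.Adj w c) (nwx : ¬ G.Adj w x) (nwy : ¬ G.Adj w y) : False := by
  apply hF
  have hxz : x ≠ z := by rintro rfl; exact nwx hzw.symm
  have hyz : y ≠ z := by rintro rfl; exact nwy hzw.symm
  have hwc : w ≠ c := by rintro rfl; exact nwx hcx
  have hwx : w ≠ x := by rintro rfl; exact nwc hcx.symm
  have hwy : w ≠ y := by rintro rfl; exact nwc hcy.symm
  have hadj : ∀ i j, G.Adj (![c, x, y, z, w] i) (![c, x, y, z, w] j) ↔ forkGraph.Adj i j := by
    intro i j
    fin_cases i <;> fin_cases j <;>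
      simp [forkGraph, hcx, hcy, hcz, hzw, nxy, nxz, nyz, nwc, nwx, nwy, hcx.symm, hcy.symm,
        hcz.symm, hzw.symm, nadj_symm nxy, nadj_symm nxz, nadj_symm nyz, nadj_symm nwc,
        nadj_symm nwx, nadj_symm nwy]
  refine ⟨⟨⟨![c, x, y, z, w], ?_⟩, fun {i j} => hadj i j⟩⟩
  · intro i j
    fin_cases i <;> fin_cases j <;>
      simp [hxy, hxy.symm, hxz, hxz.symm, hyz, hyz.symm, hwc, hwc.symm, hwx, hwx.symm, hwy,
        hwy.symm, hcx.ne, hcx.ne', hcy.ne, hcy.ne', hcz.ne, hcz.ne', hzw.ne, hzw.ne']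

lemma not_triangle_edge (hK : ¬ triangleAddEdge ⊴ G) {a b c u v : V}
    (hab : G.Adj a b) (hac : G.Adj a c) (hbc : G.Adj b c) (huv : G.Adj u v)
    (nau : ¬ G.Adj a u) (nbu : ¬ G.Adj b u) (ncu : ¬ G.Adj c u)
    (nav : ¬ G.Adj a v) (nbv : ¬ G.Adj b v) (ncv : ¬ G.Adj c v) : False := by
  apply hK
  have h1 : u ≠ a := by rintro rfl; exact nbu hab.symm
  have h2 : u ≠ b := by rintro rfl; exact nau hab
  have h3 : u ≠ c := by rintro rfl; exact nau hac
  have h4 : v ≠ a := by rintro rfl; exact nbv hab.symm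
  have h5 : v ≠ b := by rintro rfl; exact nav hab
  have h6 : v ≠ c := by rintro rfl; exact nav hac
  have hadj : ∀ i j, G.Adj (Sum.elim ![a, b, c] ![u, v] i) (Sum.elim ![a, b, c] ![u, v] j) ↔
      triangleAddEdge.Adj i j := by
    rintro (i | i) (j | j) <;> fin_cases i <;> fin_cases j <;>
      simp [triangleAddEdge, hab, hac, hbc, huv, hab.symm, hac.symm, hbc.symm, huv.symm, nau, nbu,
        ncu, nav, nbv, ncv, nadj_symm nau, nadj_symm nbu, nadj_symm ncu, nadj_symm nav,
        nadj_symm nbv, nadj_symm ncv]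
  refine ⟨⟨⟨Sum.elim ![a, b, c] ![u, v], ?_⟩, fun {i j} => hadj i j⟩⟩
  · rintro (i | i) (j | j) <;> fin_cases i <;> fin_cases j <;>
      simp [hab.ne, hab.ne', hac.ne, hac.ne', hbc.ne, hbc.ne', huv.ne, huv.ne', h1, h2, h3, h4,
        h5, h6, h1.symm, h2.symm, h3.symm, h4.symm, h5.symm, h6.symm]

/-- A set of vertices with pairwise disjoint closed neighborhoods is at most as large as any
dominating set. -/
lemma card_packing_le {S D : Finset V} (hS : ∀ s ∈ S, ∀ s' ∈ S, s ≠ s' → ¬ G.Adj s s')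
    (hS' : ∀ s ∈ S, ∀ s' ∈ S, s ≠ s' → ∀ x, G.Adj x s → ¬ G.Adj x s')
    (hD : IsDominatingSet G D) : S.card ≤ D.card := by
  have h : ∀ s, ∃ u ∈ D, u = s ∨ G.Adj u s := by
    intro s
    by_cases hs : s ∈ D
    · exact ⟨s, hs, Or.inl rfl⟩
    · obtain ⟨u, hu, hsu⟩ := hD s hs
      exact ⟨u, hu, Or.inr hsu.symm⟩
  choose f hf hf' using h
  refine Finset.card_le_card_of_injOn f (fun s _ => hf s) ?_
  intro s hs s' hs' e
  by_contra hne
  rcases hf' s with h1 | h1 <;> rcases hf' s' with h2 | h2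
  · exact hne (h1.symm.trans (e.trans h2))
  · rw [← e, h1] at h2; exact hS s hs s' hs' hne h2
  · rw [e, h2] at h1; exact hS s' hs' s hs (Ne.symm hne) h1
  · rw [← e] at h2; exact hS' s hs s' hs' hne _ h1 h2

/-! ### Cores, and the clique with private neighbors. -/

variable [Fintype V]

open Classical in
/-- The vertices that lie in `A` or have no neighbor in `A`. This is a dominating set. -/
noncomputable def domCompletion (G : SimpleGraph V) (A : Finset V) : Finset V :=
  Finset.univ.filter fun v => v ∈ A ∨ ∀ u ∈ A, ¬ G.Adj v u

lemma mem_domCompletion {A : Finset V} {v : V} :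
    v ∈ domCompletion G A ↔ v ∈ A ∨ ∀ u ∈ A, ¬ G.Adj v u := by
  simp [domCompletion]

/-- Some set of at most `m` vertices together with the vertices that it does not dominate is a
minimum dominating set. -/
def HasCore (G : SimpleGraph V) (m : ℕ) : Prop :=
  ∃ A : Finset V, A.card ≤ m ∧ ∀ D, IsDominatingSet G D → (domCompletion G A).card ≤ D.card

lemma HasCore.mono {m m' : ℕ} (h : HasCore G m) (hm : m ≤ m') : HasCore G m' := by
  obtain ⟨A, hA, h⟩ := h
  exact ⟨A, hA.trans hm, h⟩

/-- A minimum dominating set is its own completion, and it is no larger than the given one. -/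
lemma hasCore_of_dominating {m : ℕ} {D : Finset V} (hD : IsDominatingSet G D)
    (hm : D.card ≤ m) : HasCore G m := by
  obtain ⟨A, hA, hmin⟩ :=
    exists_minimalFor_of_wellFoundedLT (IsDominatingSet G) Finset.card ⟨D, hD⟩
  have hmin' : ∀ D', IsDominatingSet G D' → A.card ≤ D'.card := fun D' hD' =>
    (le_total A.card D'.card).elim id (hmin hD')
  refine ⟨A, (hmin' D hD).trans hm, fun D' hD' => le_trans (Finset.card_le_card ?_) (hmin' D' hD')⟩
  intro v hv
  by_contra hvA
  obtain ⟨u, hu, huv⟩ := hA v hvA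
  exact (mem_domCompletion.1 hv).elim hvA fun h => h u hu huv

/-- A large clique with private neighbors that are not covered by few vertices gives a core. -/
lemma hasCore_of_corona (hF : ¬ forkGraph ⊴ G) (hK : ¬ triangleAddEdge ⊴ G)
    {D : Finset V} {p : V → V}
    (hc : ∀ d ∈ D, ∀ e ∈ D, d ≠ e → G.Adj d e)
    (hp : ∀ d ∈ D, G.Adj d (p d)) (hp' : ∀ d ∈ D, ∀ e ∈ D, d ≠ e → ¬ G.Adj e (p d))
    (hpp : ∀ d ∈ D, ∀ e ∈ D, ¬ G.Adj (p d) (p e))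
    (h7 : 7 ≤ D.card)
    (hbig : ∀ x, ∀ E ⊆ D, (∀ d ∈ D, d ∉ E → G.Adj x (p d)) → 4 ≤ E.card) : HasCore G 3 := by
  classical
  -- Any three vertices of the clique serve as core. With `Z` the vertices away from `D` and its
  -- private neighbors, `D.image p ∪ Z` is a packing, so every dominating set has at least `D.card +
  -- Z.card` vertices. The completion of the core does not exceed this.
  obtain ⟨A, hAD, hA3⟩ := Finset.exists_subset_card_eq (show 3 ≤ D.card by omega)
  obtain ⟨d₁, d₂, d₃, h12, h13, h23, rfl⟩ := Finset.card_eq_three.1 hA3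
  have m1 : d₁ ∈ D := hAD (by simp)
  have m2 : d₂ ∈ D := hAD (by simp)
  have m3 : d₃ ∈ D := hAD (by simp)
  set Z : Finset V := Finset.univ.filter fun v =>
    v ∉ D ∧ v ∉ D.image p ∧ ∀ d ∈ D, ¬ G.Adj v d ∧ ¬ G.Adj v (p d) with hZ
  have pinj : Set.InjOn p D := by
    intro d hd e he h
    by_contra hne
    exact hp' d hd e he hne (h ▸ hp e he)
  have pD : ∀ d ∈ D, p d ∉ D := by
    intro d hd h
    have hne : p d ≠ d := (hp d hd).ne'
    exact hpp d hd (p d) h (hp (p d) h)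
  -- the trichotomy for the remaining vertices
  have key : ∀ v, v ∉ D → v ∉ D.image p → v ∉ Z →
      ∃ d₀ ∈ D, G.Adj v d₀ ∧ ¬ G.Adj v (p d₀) := by
    intro v hv hv' hvZ
    by_contra! hno
    obtain ⟨d, hd, hvd⟩ : ∃ d ∈ D, G.Adj v (p d) := by
      by_contra! h
      refine hvZ (Finset.mem_filter.2 ⟨Finset.mem_univ _, hv, hv', fun d hd => ⟨?_, h d hd⟩⟩)
      exact fun h' => h d hd (hno d hd h')
    -- By `hno`, being adjacent to some `e ∈ D` forces `v` to be adjacent to `p e`. Three vertices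
    -- of `D` other than `d` missed by `v` would form a triangle apart from the edge between `v` and
    -- `p d`. So at most two are missed, and `v` is adjacent to almost all private neighbors,
    -- against `hbig`.
    set E := (D.erase d).filter fun e => ¬ G.Adj v e with hE
    have hEc : E.card ≤ 2 := by
      by_contra! h
      obtain ⟨a, ha, b, hb, c, hc', hab, hac, hbc⟩ := Finset.two_lt_card.1 h
      simp only [hE, Finset.mem_filter, Finset.mem_erase] at ha hb hc'
      exact not_triangle_edge hK (hc _ ha.1.2 _ hb.1.2 hab) (hc _ ha.1.2 _ hc'.1.2 hac)
        (hc _ hb.1.2 _ hc'.1.2 hbc) hvd (nadj_symm ha.2) (nadj_symm hb.2) (nadj_symm hc'.2)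
        (hp' d hd _ ha.1.2 ha.1.1.symm) (hp' d hd _ hb.1.2 hb.1.1.symm)
        (hp' d hd _ hc'.1.2 hc'.1.1.symm)
    have := hbig v E (fun e he => Finset.mem_of_mem_erase (Finset.mem_filter.1 he).1) (by
      intro e he heE
      by_cases hed : e = d
      · exact hed ▸ hvd
      · apply hno e he
        by_contra h
        exact heE (Finset.mem_filter.2 ⟨Finset.mem_erase.2 ⟨hed, he⟩, h⟩))
    omega
  -- Such a `v` misses at most one vertex of the clique and sees at most one private neighbor. Two
  -- missed vertices give a fork centered at `d₀`, and two private neighbors give one centered at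
  -- `v` with long leg `d₀`, `p d₀`.
  have few : ∀ v d₀, d₀ ∈ D → G.Adj v d₀ → ¬ G.Adj v (p d₀) → v ∉ D.image p →
      (∀ d ∈ D, ∀ d' ∈ D, ¬ G.Adj v d → ¬ G.Adj v d' → d = d') ∧
      (∀ d ∈ D, ∀ d' ∈ D, d ≠ d' → G.Adj v (p d) → ¬ G.Adj v (p d')) := by
    intro v d₀ h0 hv0 hv0' hvp
    have n0 : ∀ d, ¬ G.Adj v d → d₀ ≠ d := by rintro d h rfl; exact h hv0
    have h1 : ∀ d ∈ D, ¬ G.Adj v d → G.Adj v (p d) := by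
      intro d hd hvd
      by_contra hvd'
      exact not_fork hF (c := d₀) (x := p d₀) (y := v) (z := d) (w := p d)
        (by rintro rfl; exact hvp (Finset.mem_image_of_mem p h0))
        (hp d₀ h0) hv0.symm (hc _ h0 _ hd (n0 d hvd)) (hp d hd) (nadj_symm hv0')
        (nadj_symm (hp' d₀ h0 d hd (n0 d hvd))) hvd
        (nadj_symm (hp' d hd d₀ h0 (n0 d hvd).symm)) (hpp d hd d₀ h0) (nadj_symm hvd')
    refine ⟨?_, ?_⟩
    · intro d hd d' hd' hvd hvd'
      by_contra hne
      exact not_fork hF (c := d₀) (x := p d₀) (y := d') (z := v) (w := p d)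
        (by intro h; exact pD d₀ h0 (h ▸ hd')) (hp d₀ h0) (hc _ h0 _ hd' (n0 d' hvd')) hv0.symm
        (h1 d hd hvd) (nadj_symm (hp' d₀ h0 d' hd' (n0 d' hvd'))) (nadj_symm hv0')
        (nadj_symm hvd') (nadj_symm (hp' d hd d₀ h0 (n0 d hvd).symm)) (hpp d hd d₀ h0)
        (nadj_symm (hp' d hd d' hd' hne))
    · intro d hd d' hd' hne hvd hvd'
      have n1 : d ≠ d₀ := by rintro rfl; exact hv0' hvd
      have n2 : d' ≠ d₀ := by rintro rfl; exact hv0' hvd'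
      exact not_fork hF (c := v) (x := p d) (y := p d') (z := d₀) (w := p d₀)
        (fun h => hne (pinj hd hd' h)) hvd hvd' hv0 (hp d₀ h0) (hpp d hd d' hd')
        (nadj_symm (hp' d hd d₀ h0 n1)) (nadj_symm (hp' d' hd' d₀ h0 n2)) (nadj_symm hv0')
        (hpp d₀ h0 d hd) (hpp d₀ h0 d' hd')
  have hZ' : ∀ z ∈ Z, z ∉ D ∧ z ∉ D.image p ∧ ∀ d ∈ D, ¬ G.Adj z d ∧ ¬ G.Adj z (p d) :=
    fun z hz => (Finset.mem_filter.1 hz).2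
  have hZZ : ∀ z ∈ Z, ∀ z' ∈ Z, ¬ G.Adj z z' := by
    intro z hz z' hz' h
    have a1 := (hZ' z hz).2.2
    have a2 := (hZ' z' hz').2.2
    exact not_triangle_edge hK (hc _ m1 _ m2 h12) (hc _ m1 _ m3 h13) (hc _ m2 _ m3 h23) h
      (nadj_symm (a1 _ m1).1) (nadj_symm (a1 _ m2).1) (nadj_symm (a1 _ m3).1)
      (nadj_symm (a2 _ m1).1) (nadj_symm (a2 _ m2).1) (nadj_symm (a2 _ m3).1)
  -- A common neighbor `x` would be the center of a fork with leaves `z`, `s` and long leg `d₀`, `p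
  -- d₀`.
  have hZx : ∀ z ∈ Z, ∀ s, s ∈ D.image p ∪ Z → z ≠ s → ∀ x, G.Adj x z → ¬ G.Adj x s := by
    intro z hz s hs hne x hxz hxs
    have hz' := hZ' z hz
    have x1 : x ∉ D := fun h => (hz'.2.2 x h).1 hxz.symm
    have x2 : x ∉ D.image p := by
      intro h
      obtain ⟨d, hd, rfl⟩ := Finset.mem_image.1 h
      exact (hz'.2.2 d hd).2 hxz.symm
    obtain ⟨d₀, h0, hx0, hx0'⟩ := key x x1 x2 fun h => hZZ x h z hz hxz
    rcases Finset.mem_union.1 hs with hs | hs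
    · obtain ⟨d, hd, rfl⟩ := Finset.mem_image.1 hs
      have n1 : d ≠ d₀ := by rintro rfl; exact hx0' hxs
      exact not_fork hF (c := x) (x := z) (y := p d) (z := d₀) (w := p d₀) hne hxz hxs hx0
        (hp d₀ h0) (hz'.2.2 d hd).2 (hz'.2.2 d₀ h0).1 (nadj_symm (hp' d hd d₀ h0 n1))
        (nadj_symm hx0') (nadj_symm (hz'.2.2 d₀ h0).2) (hpp d₀ h0 d hd)
    · have hs' := hZ' s hs
      exact not_fork hF (c := x) (x := z) (y := s) (z := d₀) (w := p d₀) hne hxz hxs hx0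
        (hp d₀ h0) (hZZ z hz s hs) (hz'.2.2 d₀ h0).1 (hs'.2.2 d₀ h0).1
        (nadj_symm hx0') (nadj_symm (hz'.2.2 d₀ h0).2) (nadj_symm (hs'.2.2 d₀ h0).2)
  refine ⟨{d₁, d₂, d₃}, hA3.le, fun D' hD' => ?_⟩
  have hpack : (D.image p ∪ Z).card ≤ D'.card := by
    refine card_packing_le ?_ ?_ hD'
    · intro s hs s' hs' hne h
      rcases Finset.mem_union.1 hs with hs | hs <;> rcases Finset.mem_union.1 hs' with hs' | hs'
      · obtain ⟨d, hd, rfl⟩ := Finset.mem_image.1 hs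
        obtain ⟨e, he, rfl⟩ := Finset.mem_image.1 hs'
        exact hpp d hd e he h
      · obtain ⟨d, hd, rfl⟩ := Finset.mem_image.1 hs
        exact ((hZ' s' hs').2.2 d hd).2 h.symm
      · obtain ⟨d, hd, rfl⟩ := Finset.mem_image.1 hs'
        exact ((hZ' s hs).2.2 d hd).2 h
      · exact hZZ s hs s' hs' h
    · intro s hs s' hs' hne x hxs hxs'
      rcases Finset.mem_union.1 hs with hs1 | hs1
      · rcases Finset.mem_union.1 hs' with hs1' | hs1'
        · obtain ⟨d, hd, rfl⟩ := Finset.mem_image.1 hs1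
          obtain ⟨e, he, rfl⟩ := Finset.mem_image.1 hs1'
          have hde : d ≠ e := fun h => hne (h ▸ rfl)
          have x1 : x ∉ D := fun h => by
            have e1 : x = d := by by_contra h'; exact hp' d hd x h (Ne.symm h') hxs
            have e2 : x = e := by by_contra h'; exact hp' e he x h (Ne.symm h') hxs'
            exact hde (e1.symm.trans e2)
          have x2 : x ∉ D.image p := by
            intro h
            obtain ⟨f, hf, rfl⟩ := Finset.mem_image.1 h
            exact hpp f hf d hd hxs
          obtain ⟨d₀, h0, hx0, hx0'⟩ := key x x1 x2 fun h => ((hZ' x h).2.2 d hd).2 hxs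
          exact (few x d₀ h0 hx0 hx0' x2).2 d hd e he hde hxs hxs'
        · exact hZx s' hs1' s hs (Ne.symm hne) x hxs' hxs
      · exact hZx s hs1 s' hs' hne x hxs hxs'
  have hdisj : Disjoint (D.image p) Z := by
    rw [Finset.disjoint_right]
    exact fun z hz => (hZ' z hz).2.1
  rw [Finset.card_union_of_disjoint hdisj, Finset.card_image_of_injOn pinj] at hpack
  -- The three chosen vertices dominate `D` and their own private neighbors. By `few`, any further
  -- vertex outside `Z` is adjacent to `d₁` or `d₂`. What is left has size at most 3 + (`D.card` -
  -- 3) + `Z.card`.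
  have hsub : domCompletion G {d₁, d₂, d₃} ⊆ ({d₁, d₂, d₃} ∪ (D \ {d₁, d₂, d₃}).image p) ∪ Z := by
    intro v hv
    by_contra hnot
    simp only [Finset.mem_union, not_or] at hnot
    obtain ⟨⟨hvA, hvp⟩, hvZ⟩ := hnot
    have hvd := (mem_domCompletion.1 hv).resolve_left hvA
    have v1 : v ∉ D := by
      intro h
      refine hvd d₁ (by simp) (hc v h d₁ m1 ?_)
      rintro rfl
      exact hvA (by simp)
    have v2 : v ∉ D.image p := by
      intro h
      obtain ⟨d, hd, rfl⟩ := Finset.mem_image.1 h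
      by_cases hdA : d ∈ ({d₁, d₂, d₃} : Finset V)
      · exact hvd d hdA (hp d hd).symm
      · exact hvp (Finset.mem_image_of_mem p (Finset.mem_sdiff.2 ⟨hd, hdA⟩))
    obtain ⟨d₀, h0, hx0, hx0'⟩ := key v v1 v2 hvZ
    exact h12 ((few v d₀ h0 hx0 hx0' v2).1 d₁ m1 d₂ m2 (hvd d₁ (by simp)) (hvd d₂ (by simp)))
  have c1 := Finset.card_le_card hsub
  have c2 := Finset.card_union_le ({d₁, d₂, d₃} ∪ (D \ {d₁, d₂, d₃}).image p) Z
  have c3 := Finset.card_union_le {d₁, d₂, d₃} ((D \ {d₁, d₂, d₃}).image p)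
  have c4 := Finset.card_image_le (s := D \ {d₁, d₂, d₃}) (f := p)
  have c5 := Finset.card_sdiff_add_card_eq_card hAD
  omega

end GraphTheory

/-! ### Cores in connected graphs, with and without triangles. -/

section GraphTheory

variable {V : Type} {G : SimpleGraph V}
/-- In a connected graph, a set of vertices that is closed under adjacency is everything. -/
lemma forall_of_connected {P : V → Prop} (hconn : G.Connected) {v : V} (hv : P v)
    (hP : ∀ u y, P u → G.Adj u y → P y) (u : V) : P u := by
  obtain ⟨W⟩ := hconn.preconnected v u
  induction W with
  | nil => exact hv
  | cons h _ ih => exact ih (hP _ _ hv h)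

/-- In a triangle-free and fork-free graph, a neighbor `x` of `v` passes its neighbors on to one of
any two other neighbors of `v`. -/
lemma adj_or_adj_of_triangleFree (hF : ¬ forkGraph ⊴ G)
    (hT : ∀ a b c, G.Adj a b → G.Adj a c → ¬ G.Adj b c) {v x y z w : V} (hyz : y ≠ z)
    (hvx : G.Adj v x) (hvy : G.Adj v y) (hvz : G.Adj v z) (hxw : G.Adj x w) :
    G.Adj w y ∨ G.Adj w z := by
  by_contra! h
  exact not_fork hF hyz hvy hvz hvx hxw (hT v y z hvy hvz) (hT v y x hvy hvx) (hT v z x hvz hvx)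
    (fun h' => hT v w x h'.symm hvx hxw.symm) h.1 h.2

/-- Cut the path into consecutive blocks of three and take the middle vertex of each. A remainder of
one or two vertices costs one more. -/
lemma exists_dominating_of_isChain [DecidableEq V] : ∀ l : List V, l.IsChain G.Adj →
    ∃ D : Finset V, D.card ≤ (l.length + 2) / 3 ∧ ∀ v ∈ l, v ∈ D ∨ ∃ u ∈ D, G.Adj v u
  | [], _ => ⟨∅, by simp⟩
  | [a], _ => ⟨{a}, by simp⟩
  | [a, b], h => ⟨{a}, by
      have : G.Adj b a := by simpa [SimpleGraph.adj_comm] using h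
      simp [this]⟩
  | a :: b :: c :: l, h => by
      have h' : G.Adj a b ∧ G.Adj b c ∧ (c :: l).IsChain G.Adj := by simpa using h
      obtain ⟨D, hD, hDl⟩ := exists_dominating_of_isChain l h'.2.2.tail
      refine ⟨insert b D, ?_, ?_⟩
      · have := Finset.card_insert_le b D
        simp only [List.length_cons]
        omega
      · intro v hv
        simp only [List.mem_cons] at hv
        rcases hv with rfl | rfl | rfl | hv
        · exact Or.inr ⟨b, by simp, h'.1⟩
        · exact Or.inl (by simp)
        · exact Or.inr ⟨b, by simp, h'.2.1.symm⟩
        · rcases hDl v hv with h | ⟨u, hu, huv⟩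
          · exact Or.inl (Finset.mem_insert_of_mem h)
          · exact Or.inr ⟨u, Finset.mem_insert_of_mem hu, huv⟩

/-- Among five neighbors of `t` with private neighbors that are not adjacent to `t`, some three
form a triangle. -/
lemma exists_triangle_of_private (hF : ¬ forkGraph ⊴ G) {F : Finset V} {p : V → V} {t : V}
    (ht : ∀ d ∈ F, G.Adj t d) (htp : ∀ d ∈ F, ¬ G.Adj t (p d))
    (hp : ∀ d ∈ F, G.Adj d (p d)) (hp' : ∀ d ∈ F, ∀ e ∈ F, d ≠ e → ¬ G.Adj e (p d))
    (hP3 : ∀ d ∈ F, ∀ e ∈ F, ∀ f ∈ F, G.Adj d e → G.Adj d f → e ≠ f → G.Adj e f)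
    (h5 : 5 ≤ F.card) :
    ∃ d ∈ F, ∃ e ∈ F, ∃ f ∈ F, G.Adj d e ∧ G.Adj d f ∧ G.Adj e f := by
  classical
  by_contra! hno
  -- Without a triangle, `hP3` leaves each vertex at most one neighbor in `F`. Removing two closed
  -- neighborhoods of size at most two from five vertices leaves a third vertex, hence three
  -- pairwise nonadjacent neighbors of `t`. One of them with its private neighbor is the long leg of
  -- a fork at `t`.
  have small : ∀ d ∈ F, (F.filter fun x => x = d ∨ G.Adj d x).card ≤ 2 := by
    intro d hd
    by_contra! h
    have h' : 1 < ((F.filter fun x => x = d ∨ G.Adj d x).erase d).card := by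
      have := Finset.pred_card_le_card_erase (s := F.filter fun x => x = d ∨ G.Adj d x) (a := d)
      omega
    obtain ⟨x, hx, y, hy, hxy⟩ := Finset.one_lt_card.1 h'
    simp only [Finset.mem_erase, Finset.mem_filter] at hx hy
    have hdx := hx.2.2.resolve_left hx.1
    have hdy := hy.2.2.resolve_left hy.1
    exact hno d hd x hx.2.1 y hy.2.1 hdx hdy (hP3 d hd x hx.2.1 y hy.2.1 hdx hdy hxy)
  obtain ⟨d₁, h1⟩ : F.Nonempty := Finset.card_pos.1 (by omega)
  set C₁ := F.filter fun x => x = d₁ ∨ G.Adj d₁ x with hC₁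
  have s1 : C₁.card ≤ 2 := small d₁ h1
  have s2 : 3 ≤ (F \ C₁).card := by
    have := Finset.le_card_sdiff C₁ F
    omega
  obtain ⟨d₂, h2⟩ : (F \ C₁).Nonempty := Finset.card_pos.1 (by omega)
  obtain ⟨h2, h2'⟩ := Finset.mem_sdiff.1 h2
  set C₂ := F.filter fun x => x = d₂ ∨ G.Adj d₂ x with hC₂
  have s3 : C₂.card ≤ 2 := small d₂ h2
  have s4 : 1 ≤ ((F \ C₁) \ C₂).card := by
    have := Finset.le_card_sdiff C₂ (F \ C₁)
    omega
  obtain ⟨d₃, h3⟩ : ((F \ C₁) \ C₂).Nonempty := Finset.card_pos.1 (by omega)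
  obtain ⟨h3, h3''⟩ := Finset.mem_sdiff.1 h3
  obtain ⟨h3, h3'⟩ := Finset.mem_sdiff.1 h3
  simp only [hC₁, hC₂, Finset.mem_filter, not_and, not_or] at h2' h3' h3''
  obtain ⟨n21, n21'⟩ := h2' h2
  obtain ⟨n31, n31'⟩ := h3' h3
  obtain ⟨n32, n32'⟩ := h3'' h3
  exact not_fork hF (c := t) (x := d₂) (y := d₃) (z := d₁) (w := p d₁) (Ne.symm n32)
    (ht _ h2) (ht _ h3) (ht _ h1) (hp _ h1) n32' (nadj_symm n21') (nadj_symm n31')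
    (nadj_symm (htp _ h1)) (nadj_symm (hp' _ h1 _ h2 (Ne.symm n21)))
    (nadj_symm (hp' _ h1 _ h3 (Ne.symm n31)))

variable [Fintype V]

/-- A smallest set `D` of neighbors of the triangle that dominates the non-neighbors `I` is either
small enough to give a dominating set directly, or a large clique with private neighbors, to which
`hasCore_of_corona` applies. -/
theorem hasCore_of_triangle (hF : ¬ forkGraph ⊴ G) (hK : ¬ triangleAddEdge ⊴ G)
    (hiso : ∀ v, ∃ u, G.Adj v u) {a b c : V} (hab : G.Adj a b) (hac : G.Adj a c)
    (hbc : G.Adj b c) : HasCore G 15 := by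
  classical
  set T : Finset V := {a, b, c} with hT
  have hT3 : T.card ≤ 3 := Finset.card_le_three
  have aT : a ∈ T := by simp [hT]
  have bT : b ∈ T := by simp [hT]
  have cT : c ∈ T := by simp [hT]
  set I : Finset V := Finset.univ.filter fun v => v ∉ T ∧ ∀ t ∈ T, ¬ G.Adj t v with hIdef
  set N : Finset V := Finset.univ.filter fun v => v ∉ T ∧ ∃ t ∈ T, G.Adj t v with hNdef
  have memI : ∀ v, v ∈ I ↔ v ∉ T ∧ ∀ t ∈ T, ¬ G.Adj t v := by simp [hIdef]
  have memN : ∀ v, v ∈ N ↔ v ∉ T ∧ ∃ t ∈ T, G.Adj t v := by simp [hNdef]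
  have hI : ∀ i ∈ I, ∀ j ∈ I, ¬ G.Adj i j := by
    intro i hi j hj hij
    have hi' := ((memI i).1 hi).2
    have hj' := ((memI j).1 hj).2
    exact not_triangle_edge hK hab hac hbc hij (hi' a aT) (hi' b bT) (hi' c cT)
      (hj' a aT) (hj' b bT) (hj' c cT)
  have hIN : ∀ i ∈ I, ∀ v, G.Adj i v → v ∈ N := by
    intro i hi v hiv
    have hvT : v ∉ T := fun h => ((memI i).1 hi).2 v h hiv.symm
    refine (memN v).2 ⟨hvT, ?_⟩
    by_contra! h
    exact hI i hi v ((memI v).2 ⟨hvT, h⟩) hiv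
  obtain ⟨D, ⟨hDN, hDI⟩, hmin⟩ := exists_minimalFor_of_wellFoundedLT
    (fun D : Finset V => D ⊆ N ∧ ∀ i ∈ I, ∃ d ∈ D, G.Adj d i) Finset.card
    ⟨N, subset_rfl, fun i hi => by
      obtain ⟨u, hu⟩ := hiso i
      exact ⟨u, hIN i hi u hu, hu.symm⟩⟩
  have hmin' : ∀ D' : Finset V, D' ⊆ N → (∀ i ∈ I, ∃ d ∈ D', G.Adj d i) → D.card ≤ D'.card :=
    fun D' h1 h2 => (le_total D.card D'.card).elim id (hmin ⟨h1, h2⟩)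
  -- The threshold serves both cases: 3 + 12 = 15 is the size allowed for a core, and more than 12 =
  -- 3 · 4 vertices put five of `D` next to the same vertex of the triangle.
  by_cases h12 : D.card ≤ 12
  · refine hasCore_of_dominating (D := T ∪ D) ?_ ?_
    · intro v hv
      simp only [Finset.mem_union, not_or] at hv
      by_cases hvI : v ∈ I
      · obtain ⟨d, hd, hdv⟩ := hDI v hvI
        exact ⟨d, Finset.mem_union_right _ hd, hdv.symm⟩
      · rw [memI] at hvI
        push Not at hvI
        obtain ⟨t, ht, htv⟩ := hvI hv.1
        exact ⟨t, Finset.mem_union_left _ ht, htv.symm⟩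
    · exact (Finset.card_union_le _ _).trans (by omega)
  -- By minimality, deleting `d` leaves some vertex of `I` undominated; this is its private
  -- neighbor.
  have hpr : ∀ d, ∃ i, d ∈ D → i ∈ I ∧ G.Adj d i ∧ ∀ e ∈ D, d ≠ e → ¬ G.Adj e i := by
    intro d
    by_cases hd : d ∈ D
    · by_contra! h
      have := hmin' (D.erase d) ((Finset.erase_subset _ _).trans hDN) (by
        intro i hi
        by_cases hdi : G.Adj d i
        · obtain ⟨e, he, hde, hei⟩ := (h i).2 hi hdi
          exact ⟨e, Finset.mem_erase.2 ⟨hde.symm, he⟩, hei⟩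
        · obtain ⟨e, he, hei⟩ := hDI i hi
          exact ⟨e, Finset.mem_erase.2 ⟨by rintro rfl; exact hdi hei, he⟩, hei⟩)
      have := Finset.card_erase_lt_of_mem hd
      omega
    · exact ⟨d, fun h => absurd h hd⟩
  choose p hp using hpr
  have hpI : ∀ d ∈ D, p d ∈ I := fun d hd => (hp d hd).1
  have hpa : ∀ d ∈ D, G.Adj d (p d) := fun d hd => (hp d hd).2.1
  have hp' : ∀ d ∈ D, ∀ e ∈ D, d ≠ e → ¬ G.Adj e (p d) := fun d hd => (hp d hd).2.2
  have hpp : ∀ d ∈ D, ∀ e ∈ D, ¬ G.Adj (p d) (p e) :=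
    fun d hd e he => hI _ (hpI d hd) _ (hpI e he)
  -- An induced path on `e`, `d`, `f` extends to a fork at `d` with leaves `p d`, `e` and long leg
  -- `f`, `p f`. So `D` induces a disjoint union of cliques.
  have hP3 : ∀ d ∈ D, ∀ e ∈ D, ∀ f ∈ D, G.Adj d e → G.Adj d f → e ≠ f → G.Adj e f := by
    intro d hd e he f hf hde hdf hef
    by_contra hnef
    have hne : p d ≠ e := by
      rintro rfl
      obtain ⟨t, ht, hte⟩ := ((memN _).1 (hDN he)).2
      exact ((memI _).1 (hpI d hd)).2 t ht hte
    exact not_fork hF (c := d) (x := p d) (y := e) (z := f) (w := p f) hne (hpa d hd) hde hdf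
      (hpa f hf) (nadj_symm (hp' d hd e he hde.ne)) (nadj_symm (hp' d hd f hf hdf.ne)) hnef
      (nadj_symm (hp' f hf d hd hdf.ne')) (hpp f hf d hd) (nadj_symm (hp' f hf e he hef.symm))
  have hclique : ∀ d ∈ D, ∀ e ∈ D, d ≠ e → G.Adj d e := by
    have hTD : ∀ d, ∃ t, d ∈ D → t ∈ T ∧ G.Adj t d := by
      intro d
      by_cases hd : d ∈ D
      · obtain ⟨t, ht, h⟩ := ((memN d).1 (hDN hd)).2
        exact ⟨t, fun _ => ⟨ht, h⟩⟩
      · exact ⟨d, fun h => absurd h hd⟩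
    choose τ hτ using hTD
    obtain ⟨t, ht, h4⟩ := Finset.exists_lt_card_fiber_of_mul_lt_card_of_maps_to
      (s := D) (t := T) (f := τ) (n := 4) (fun d hd => (hτ d hd).1) (by omega)
    obtain ⟨d₁, h1, d₂, h2, d₃, h3, a12, a13, a23⟩ := exists_triangle_of_private hF (t := t)
      (F := D.filter fun d => τ d = t) (p := p)
      (fun d hd => by
        obtain ⟨hd', rfl⟩ := Finset.mem_filter.1 hd
        exact (hτ d hd').2)
      (fun d hd => ((memI _).1 (hpI d (Finset.mem_filter.1 hd).1)).2 t ht)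
      (fun d hd => hpa d (Finset.mem_filter.1 hd).1)
      (fun d hd e he => hp' d (Finset.mem_filter.1 hd).1 e (Finset.mem_filter.1 he).1)
      (fun d hd e he f hf => hP3 d (Finset.mem_filter.1 hd).1 e (Finset.mem_filter.1 he).1 f
        (Finset.mem_filter.1 hf).1) h4
    replace h1 := (Finset.mem_filter.1 h1).1
    replace h2 := (Finset.mem_filter.1 h2).1
    replace h3 := (Finset.mem_filter.1 h3).1
    -- A vertex `e` outside the clique of the triangle would give, with `p e`, an edge apart from
    -- it.
    have hall : ∀ e ∈ D, e ≠ d₁ → G.Adj d₁ e := by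
      intro e he hne
      by_contra hn
      have e2 : e ≠ d₂ := by rintro rfl; exact hn a12
      have e3 : e ≠ d₃ := by rintro rfl; exact hn a13
      exact not_triangle_edge hK a12 a13 a23 (hpa e he) hn
        (fun h => hn (hP3 d₂ h2 d₁ h1 e he a12.symm h hne.symm))
        (fun h => hn (hP3 d₃ h3 d₁ h1 e he a13.symm h hne.symm))
        (hp' e he d₁ h1 hne) (hp' e he d₂ h2 e2) (hp' e he d₃ h3 e3)
    intro d hd e he hne
    by_cases hd1 : d = d₁
    · exact hd1 ▸ hall e he (hd1 ▸ hne.symm)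
    by_cases he1 : e = d₁
    · exact (he1 ▸ hall d hd hd1).symm
    exact hP3 d₁ h1 d hd e he (hall d hd hd1) (hall e he he1) hne
  refine (hasCore_of_corona hF hK hclique hpa hp' hpp (by omega) ?_).mono (by omega)
  intro x E hED hE
  by_contra! hE4
  obtain ⟨d₀, h0⟩ : D.Nonempty := Finset.card_pos.1 (by omega)
  obtain ⟨d, hd⟩ : (D \ E).Nonempty := Finset.card_pos.1 (by
    have := Finset.le_card_sdiff E D
    omega)
  obtain ⟨hd, hdE⟩ := Finset.mem_sdiff.1 hd
  have hxN : x ∈ N := hIN _ (hpI d hd) x (hE d hd hdE).symm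
  -- Every vertex of `I` that is not the private neighbor of a neighbor `e` in `D` is adjacent to
  -- `d₀`, by a fork at `e`. So `x`, `d₀` and `E`, at most five vertices, dominate `I`, although `D`
  -- is minimum with at least 13.
  have := hmin' (insert x (insert d₀ E)) (by
    intro y hy
    simp only [Finset.mem_insert] at hy
    rcases hy with rfl | rfl | hy
    · exact hxN
    · exact hDN h0
    · exact hDN (hED hy)) (by
    intro i hi
    obtain ⟨e, he, hei⟩ := hDI i hi
    by_cases hie : i = p e
    · subst hie
      by_cases heE : e ∈ E
      · exact ⟨e, by simp [heE], hei⟩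
      · exact ⟨x, by simp, hE e he heE⟩
    · refine ⟨d₀, by simp, ?_⟩
      by_contra hn
      have hne : e ≠ d₀ := by rintro rfl; exact hn hei
      exact not_fork hF (c := e) (x := p e) (y := i) (z := d₀) (w := p d₀) (Ne.symm hie)
        (hpa e he) hei (hclique e he d₀ h0 hne) (hpa d₀ h0) (hI _ (hpI e he) _ hi)
        (nadj_symm (hp' e he d₀ h0 hne)) (nadj_symm hn) (nadj_symm (hp' d₀ h0 e he hne.symm))
        (hpp d₀ h0 e he) (hI _ (hpI d₀ h0) _ hi))
  have c1 := Finset.card_insert_le x (insert d₀ E)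
  have c2 := Finset.card_insert_le d₀ E
  omega

/-- Forks at `v` make every vertex at distance two adjacent to at least two of the three neighbors,
so two such vertices always share one. Further forks bound all distances from `v` by three and give
the vertices at distance three a common neighbor `w₁`. Then `v`, `x₁`, `x₂`, `w₁` dominate. -/
theorem hasCore_of_triangleFree (hF : ¬ forkGraph ⊴ G) (hconn : G.Connected)
    (hT : ∀ a b c, G.Adj a b → G.Adj a c → ¬ G.Adj b c) {v x₁ x₂ x₃ : V}
    (h12 : x₁ ≠ x₂) (h13 : x₁ ≠ x₃) (h23 : x₂ ≠ x₃)
    (h1 : G.Adj v x₁) (h2 : G.Adj v x₂) (h3 : G.Adj v x₃) : HasCore G 4 := by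
  classical
  -- each vertex at distance two from `v` misses at most one of the three neighbors
  have two : ∀ x w, G.Adj v x → G.Adj x w → w ≠ v →
      (G.Adj w x₁ ∧ G.Adj w x₂) ∨ (G.Adj w x₁ ∧ G.Adj w x₃) ∨ (G.Adj w x₂ ∧ G.Adj w x₃) := by
    intro x w hvx hxw
    have a12 := adj_or_adj_of_triangleFree hF hT h12 hvx h1 h2 hxw
    have a13 := adj_or_adj_of_triangleFree hF hT h13 hvx h1 h3 hxw
    have a23 := adj_or_adj_of_triangleFree hF hT h23 hvx h2 h3 hxw
    tauto
  have two' : ∀ w w', (∃ x, G.Adj v x ∧ G.Adj x w) → (∃ x, G.Adj v x ∧ G.Adj x w') → w ≠ v →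
      w' ≠ v → ∃ x, G.Adj v x ∧ G.Adj x w ∧ G.Adj x w' := by
    rintro w w' ⟨x, hx, hxw⟩ ⟨x', hx', hxw'⟩ hw hw'
    have a := two x w hx hxw hw
    have a' := two x' w' hx' hxw' hw'
    have : (G.Adj w x₁ ∧ G.Adj w' x₁) ∨ (G.Adj w x₂ ∧ G.Adj w' x₂) ∨
        (G.Adj w x₃ ∧ G.Adj w' x₃) := by tauto
    rcases this with h | h | h
    · exact ⟨x₁, h1, h.1.symm, h.2.symm⟩
    · exact ⟨x₂, h2, h.1.symm, h.2.symm⟩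
    · exact ⟨x₃, h3, h.1.symm, h.2.symm⟩
  have pair : ∀ w, (∃ x, G.Adj v x ∧ G.Adj x w) → w ≠ v →
      ∃ x y, x ≠ y ∧ G.Adj v x ∧ G.Adj v y ∧ G.Adj w x ∧ G.Adj w y := by
    rintro w ⟨x, hx, hxw⟩ hw
    rcases two x w hx hxw hw with h | h | h
    · exact ⟨x₁, x₂, h12, h1, h2, h⟩
    · exact ⟨x₁, x₃, h13, h1, h3, h⟩
    · exact ⟨x₂, x₃, h23, h2, h3, h⟩
  set N2 : V → Prop := fun w => w ≠ v ∧ ∃ x, G.Adj v x ∧ G.Adj x w with hN2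
  set B : V → Prop := fun w => w = v ∨ G.Adj v w ∨ N2 w with hB
  -- every vertex is within distance three
  have near : ∀ u, B u ∨ ∃ w, N2 w ∧ G.Adj w u := by
    intro u
    refine forall_of_connected hconn (P := fun u => B u ∨ ∃ w, N2 w ∧ G.Adj w u) (v := v)
      (Or.inl (Or.inl rfl)) ?_ u
    rintro u y (hu | ⟨w, hw, hwu⟩) huy
    · rcases hu with rfl | hu | hu
      · exact Or.inl (Or.inr (Or.inl huy))
      · by_cases hyv : y = v
        · exact Or.inl (Or.inl hyv)
        · exact Or.inl (Or.inr (Or.inr ⟨hyv, u, hu, huy⟩))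
      · exact Or.inr ⟨u, hu, huy⟩
    · obtain ⟨x, y', hne, hx, hy', hwx, hwy'⟩ := pair w hw.2 hw.1
      left
      by_cases hyv : y = v
      · exact Or.inl hyv
      rcases adj_or_adj_of_triangleFree hF hT hne hwu hwx hwy' huy with h | h
      · exact Or.inr (Or.inr ⟨hyv, x, hx, h.symm⟩)
      · exact Or.inr (Or.inr ⟨hyv, y', hy', h.symm⟩)
  -- the vertices at distance three have a common neighbor
  have far : ∃ w₁, ∀ u, ¬ B u → G.Adj w₁ u := by
    by_cases hfar : ∃ u, ¬ B u
    · obtain ⟨u₁, hu₁⟩ := hfar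
      obtain ⟨w₁, hw₁, h11⟩ := (near u₁).resolve_left hu₁
      refine ⟨w₁, fun u₂ hu₂ => ?_⟩
      by_contra hn
      obtain ⟨w₂, hw₂, h22⟩ := (near u₂).resolve_left hu₂
      simp only [hB, not_or] at hu₁ hu₂
      obtain ⟨x, hvx, hx1, hx2⟩ := two' w₁ w₂ hw₁.2 hw₂.2 hw₁.1 hw₂.1
      have nx1 : ¬ G.Adj u₁ x := fun h => hu₁.2.2 ⟨hu₁.1, x, hvx, h.symm⟩
      have nx2 : ¬ G.Adj u₂ x := fun h => hu₂.2.2 ⟨hu₂.1, x, hvx, h.symm⟩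
      have nw1 : ¬ G.Adj v w₁ := fun h => hT x v w₁ hvx.symm hx1 h
      have nw2 : ¬ G.Adj v w₂ := fun h => hT x v w₂ hvx.symm hx2 h
      have nww : ¬ G.Adj w₁ w₂ := hT x w₁ w₂ hx1 hx2
      by_cases h21 : G.Adj w₂ u₁
      -- The fork is centered at `w₂` with long leg `x`, `v` if `w₂` is adjacent to `u₁`, and
      -- otherwise at `x` with long leg `w₁`, `u₁`.
      · have hne : u₁ ≠ u₂ := by rintro rfl; exact hn h11
        exact not_fork hF (c := w₂) (x := u₁) (y := u₂) (z := x) (w := v) hne h21 h22 hx2.symm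
          hvx.symm (hT w₂ u₁ u₂ h21 h22) nx1 nx2 nw2 hu₁.2.1 hu₂.2.1
      · exact not_fork hF (c := x) (x := v) (y := w₂) (z := w₁) (w := u₁) hw₂.1.symm hvx.symm hx2
          hx1 h11 nw2 nw1 (nadj_symm nww) nx1 (nadj_symm hu₁.2.1) (nadj_symm h21)
    · push Not at hfar
      exact ⟨v, fun u hu => absurd (hfar u) hu⟩
  obtain ⟨w₁, hw₁⟩ := far
  refine hasCore_of_dominating (D := {v, x₁, x₂, w₁}) ?_ Finset.card_le_four
  intro u hu
  by_cases hBu : B u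
  · rcases hBu with rfl | h | ⟨h, x, hvx, hxu⟩
    · simp at hu
    · exact ⟨v, by simp, h.symm⟩
    · rcases two x u hvx hxu h with h | h | h
      · exact ⟨x₁, by simp, h.1⟩
      · exact ⟨x₁, by simp, h.1⟩
      · exact ⟨x₂, by simp, h.1⟩
  · exact ⟨w₁, by simp, (hw₁ u hBu).symm⟩

theorem hasCore_of_three_le_degree (hF : ¬ forkGraph ⊴ G) (hK : ¬ triangleAddEdge ⊴ G)
    (hconn : G.Connected) {v x₁ x₂ x₃ : V} (h12 : x₁ ≠ x₂) (h13 : x₁ ≠ x₃) (h23 : x₂ ≠ x₃)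
    (h1 : G.Adj v x₁) (h2 : G.Adj v x₂) (h3 : G.Adj v x₃) : HasCore G 15 := by
  by_cases hT : ∃ a b c, G.Adj a b ∧ G.Adj a c ∧ G.Adj b c
  · obtain ⟨a, b, c, hab, hac, hbc⟩ := hT
    have : Nontrivial V := ⟨⟨v, x₁, h1.ne⟩⟩
    exact hasCore_of_triangle hF hK (fun u => hconn.preconnected.exists_adj_of_nontrivial u)
      hab hac hbc
  · push Not at hT
    exact (hasCore_of_triangleFree hF hconn hT h12 h13 h23 h1 h2 h3).mono (by omega)

/-! ### Paths and cycles -/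

/-- Take a longest path. If it misses a vertex, connectivity gives an edge from some `u` on it to
some `y` off it. An end `u` would allow an extension, and an interior `u` would have three
neighbors. -/
lemma exists_hamiltonian_chain (hconn : G.Connected)
    (hdeg : ∀ v x₁ x₂ x₃ : V, x₁ ≠ x₂ → x₁ ≠ x₃ → x₂ ≠ x₃ → G.Adj v x₁ → G.Adj v x₂ →
      ¬ G.Adj v x₃) :
    ∃ l : List V, l.IsChain G.Adj ∧ l.Nodup ∧ ∀ v, v ∈ l := by
  classical
  have hbound : ∀ l : List V, l.Nodup → l.length ≤ Fintype.card V := fun l hl =>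
    hl.length_le_card
  obtain ⟨l, ⟨hl, hnd⟩, hmax⟩ : ∃ l : List V, (l.IsChain G.Adj ∧ l.Nodup) ∧
      ∀ l' : List V, l'.IsChain G.Adj → l'.Nodup → l'.length ≤ l.length := by
    have hex : ∃ m, ∃ l : List V, (l.IsChain G.Adj ∧ l.Nodup) ∧ Fintype.card V - l.length = m :=
      ⟨_, [], by simp, rfl⟩
    obtain ⟨l, h, he⟩ := Nat.find_spec hex
    refine ⟨l, h, fun l' h1 h2 => ?_⟩
    have := Nat.find_min' hex ⟨l', ⟨h1, h2⟩, rfl⟩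
    have := hbound l h.2
    have := hbound l' h2
    omega
  refine ⟨l, hl, hnd, ?_⟩
  obtain ⟨v₀⟩ := hconn.nonempty
  obtain ⟨a, ha⟩ : ∃ a, a ∈ l := by
    by_contra! h
    have := hmax [v₀] (by simp) (by simp)
    rw [List.eq_nil_iff_forall_not_mem.2 h] at this
    simp at this
  refine forall_of_connected hconn (P := fun v => v ∈ l) ha ?_
  intro u y hu huy
  by_contra hy
  obtain ⟨s, t, rfl⟩ := List.append_of_mem hu
  simp only [List.mem_append, List.mem_cons, not_or] at hy
  rcases List.eq_nil_or_concat s with rfl | ⟨s', p, rfl⟩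
  · have := hmax (y :: u :: t) (by simpa using ⟨huy.symm, by simpa using hl⟩)
      (by simp at hnd ⊢; tauto)
    simp at this
  · cases t with
    | nil =>
      have := hmax (s' ++ [p] ++ [u] ++ [y]) (by
        rw [List.isChain_append]
        refine ⟨by simpa using hl, by simp, ?_⟩
        simpa using huy) (by
        rw [List.nodup_append]
        refine ⟨by simpa using hnd, by simp, ?_⟩
        intro a ha b hb
        simp only [List.mem_singleton] at hb
        subst hb
        rintro rfl
        simp at ha hy
        tauto)
      simp at this
    | cons q t =>
      simp only [List.concat_eq_append, List.append_assoc, List.cons_append, List.nil_append] at hl hnd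
      rw [List.isChain_append] at hl
      have h1 : G.Adj p u ∧ G.Adj u q := by
        have := hl.2.1
        simp at this
        tauto
      simp only [List.mem_append, List.mem_cons, List.concat_eq_append] at hy
      have hpq : p ≠ q := by
        rintro rfl
        rw [List.nodup_append] at hnd
        simp at hnd
      refine hdeg u p q y hpq ?_ ?_ h1.1.symm h1.2 huy
      · rintro rfl; simp at hy
      · rintro rfl; simp at hy

/-- The domination number of a path or a cycle. -/
theorem exists_dominating_of_degree_le_two (hconn : G.Connected)
    (hdeg : ∀ v x₁ x₂ x₃ : V, x₁ ≠ x₂ → x₁ ≠ x₃ → x₂ ≠ x₃ → G.Adj v x₁ → G.Adj v x₂ →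
      ¬ G.Adj v x₃) :
    ∃ D : Finset V, IsDominatingSet G D ∧ D.card ≤ (Fintype.card V + 2) / 3 := by
  classical
  obtain ⟨l, hl, hnd, hall⟩ := exists_hamiltonian_chain hconn hdeg
  obtain ⟨D, hD, hDl⟩ := exists_dominating_of_isChain l hl
  refine ⟨D, fun v hv => (hDl v (hall v)).resolve_left hv, hD.trans ?_⟩
  have := hnd.length_le_card
  omega

/-- Closed neighborhoods have at most three vertices, and those of `D` cover the graph. -/
theorem card_le_three_mul_card_of_degree_le_two
    (hdeg : ∀ v x₁ x₂ x₃ : V, x₁ ≠ x₂ → x₁ ≠ x₃ → x₂ ≠ x₃ → G.Adj v x₁ → G.Adj v x₂ →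
      ¬ G.Adj v x₃) {D : Finset V} (hD : IsDominatingSet G D) :
    Fintype.card V ≤ 3 * D.card := by
  classical
  have h1 : (Finset.univ : Finset V) ⊆
      D.biUnion fun d => Finset.univ.filter fun v => v = d ∨ G.Adj d v := by
    intro v _
    simp only [Finset.mem_biUnion, Finset.mem_filter, Finset.mem_univ, true_and]
    by_cases hv : v ∈ D
    · exact ⟨v, hv, Or.inl rfl⟩
    · obtain ⟨u, hu, huv⟩ := hD v hv
      exact ⟨u, hu, Or.inr huv.symm⟩
  have h2 := Finset.card_le_card h1
  have h3 : (D.biUnion fun d => Finset.univ.filter fun v => v = d ∨ G.Adj d v).card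
      ≤ D.card * 3 := by
    refine Finset.card_biUnion_le_card_mul _ _ _ fun d _ => ?_
    by_contra! h
    have h' : 2 < ((Finset.univ.filter fun v => v = d ∨ G.Adj d v).erase d).card := by
      have := Finset.pred_card_le_card_erase
        (s := Finset.univ.filter fun v => v = d ∨ G.Adj d v) (a := d)
      omega
    obtain ⟨x, hx, y, hy, z, hz, hxy, hxz, hyz⟩ := Finset.two_lt_card.1 h'
    simp only [Finset.mem_erase, Finset.mem_filter, Finset.mem_univ, true_and] at hx hy hz
    exact hdeg d x y z hxy hxz hyz (hx.2.resolve_left hx.1) (hy.2.resolve_left hy.1)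
      (hz.2.resolve_left hz.1)
  rw [Finset.card_univ] at h2
  omega

end GraphTheory

/-! ### Domination by components -/

section Components

variable {n : ℕ} {G : SimpleGraph (Fin n)}

open Classical in
/-- The vertex set of the component of `v`. -/
noncomputable def componentOf (G : SimpleGraph (Fin n)) (v : Fin n) : Finset (Fin n) :=
  Finset.univ.filter fun u => G.Reachable v u

lemma mem_componentOf {v u : Fin n} : u ∈ componentOf G v ↔ G.Reachable v u := by
  simp [componentOf]

/-- `v` is the least vertex of its component. -/
def IsLeastInComponent (G : SimpleGraph (Fin n)) (v : Fin n) : Prop :=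
  ∀ u, G.Reachable v u → v ≤ u

/-- `D` is a dominating set of the component of `v`. -/
def DominatesComponent (G : SimpleGraph (Fin n)) (v : Fin n) (D : Finset (Fin n)) : Prop :=
  D ⊆ componentOf G v ∧ ∀ u ∈ componentOf G v, u ∉ D → ∃ w ∈ D, G.Adj u w

/-- `m` is the domination number of the component of `v`. -/
def IsComponentDominationNumber (G : SimpleGraph (Fin n)) (v : Fin n) (m : ℕ) : Prop :=
  (∃ D, DominatesComponent G v D ∧ D.card ≤ m) ∧ ∀ D, DominatesComponent G v D → m ≤ D.card

lemma exists_leastInComponent (G : SimpleGraph (Fin n)) (u : Fin n) :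
    ∃ v, IsLeastInComponent G v ∧ G.Reachable v u := by
  classical
  have hne : (componentOf G u).Nonempty := ⟨u, mem_componentOf.2 (SimpleGraph.Reachable.refl u)⟩
  have hm := mem_componentOf.1 (Finset.min'_mem _ hne)
  refine ⟨(componentOf G u).min' hne, fun w hw => ?_, hm.symm⟩
  exact Finset.min'_le _ _ (mem_componentOf.2 (hm.trans hw))

-- Dominating sets of the components unite to one of the graph, and conversely a dominating set
-- splits into its disjoint intersections with the components. Least vertices serve as
-- representatives because a term can test for them.
open Classical in
theorem dominationNumber_eq_sum {g : Fin n → ℕ}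
    (hg : ∀ v, IsLeastInComponent G v → IsComponentDominationNumber G v (g v)) :
    dominationNumber G = ∑ v, if IsLeastInComponent G v then g v else 0 := by
  rw [← Finset.sum_filter]
  set R : Finset (Fin n) := Finset.univ.filter (IsLeastInComponent G) with hR
  have hRm : ∀ v, v ∈ R ↔ IsLeastInComponent G v := by simp [hR]
  have uniq : ∀ v ∈ R, ∀ w ∈ R, ∀ u, G.Reachable v u → G.Reachable w u → v = w := by
    intro v hv w hw u h1 h2
    exact le_antisymm ((hRm v).1 hv w (h1.trans h2.symm)) ((hRm w).1 hw v (h2.trans h1.symm))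
  unfold dominationNumber
  apply le_antisymm
  · choose D hD hDg using fun v : R => (hg v ((hRm v).1 v.2)).1
    refine le_trans (Nat.sInf_le ⟨R.attach.biUnion D, ?_, rfl⟩) ?_
    · intro u hu
      obtain ⟨v, hv, hvu⟩ := exists_leastInComponent G u
      have hv' := (hRm v).2 hv
      obtain ⟨w, hw, huw⟩ := (hD ⟨v, hv'⟩).2 u (mem_componentOf.2 hvu) (fun h => hu
        (Finset.mem_biUnion.2 ⟨⟨v, hv'⟩, Finset.mem_attach _ _, h⟩))
      exact ⟨w, Finset.mem_biUnion.2 ⟨⟨v, hv'⟩, Finset.mem_attach _ _, hw⟩, huw⟩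
    · refine Finset.card_biUnion_le.trans ?_
      rw [← Finset.sum_attach R g]
      exact Finset.sum_le_sum fun v _ => hDg v
  · refine le_csInf ⟨_, Finset.univ, fun v hv => absurd (Finset.mem_univ v) hv, rfl⟩ ?_
    rintro m ⟨D, hD, rfl⟩
    calc ∑ v ∈ R, g v ≤ ∑ v ∈ R, (D ∩ componentOf G v).card := by
          refine Finset.sum_le_sum fun v hv => (hg v ((hRm v).1 hv)).2 _ ⟨Finset.inter_subset_right,
            fun u hu huD => ?_⟩
          have huD' : u ∉ D := fun h => huD (Finset.mem_inter.2 ⟨h, hu⟩)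
          obtain ⟨w, hw, huw⟩ := hD u huD'
          exact ⟨w, Finset.mem_inter.2 ⟨hw, mem_componentOf.2
            ((mem_componentOf.1 hu).trans huw.reachable)⟩, huw⟩
      _ = (R.biUnion fun v => D ∩ componentOf G v).card := by
          rw [Finset.card_biUnion]
          intro v hv w hw hne
          rw [Function.onFun, Finset.disjoint_left]
          intro u hu hu'
          exact hne (uniq v hv w hw u (mem_componentOf.1 (Finset.mem_inter.1 hu).2)
            (mem_componentOf.1 (Finset.mem_inter.1 hu').2))
      _ ≤ D.card := Finset.card_le_card (Finset.biUnion_subset.2 fun v _ =>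
          Finset.inter_subset_left)

/-! ### Tuples whose completion is a minimum dominating set of a component. -/

open Classical in
/-- The vertices of the component of `v` that are in the tuple `a` or have no neighbor in it. -/
noncomputable def componentCompletion (G : SimpleGraph (Fin n)) (v : Fin n) {m : ℕ}
    (a : Fin m → Fin n) : Finset (Fin n) :=
  (componentOf G v).filter fun u => (∃ i, u = a i) ∨ ∀ i, ¬ G.Adj u (a i)

/-- The tuple may leave the component, which does no harm: an entry adjacent to a vertex of the
component lies in it. Hence one may minimize over all tuples. -/
lemma dominatesComponent_componentCompletion (v : Fin n) {m : ℕ} (a : Fin m → Fin n) :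
    DominatesComponent G v (componentCompletion G v a) := by
  classical
  refine ⟨Finset.filter_subset _ _, fun u hu hu' => ?_⟩
  simp only [componentCompletion, Finset.mem_filter, hu, true_and, not_or] at hu'
  push Not at hu'
  obtain ⟨-, i, hi⟩ := hu'
  exact ⟨a i, Finset.mem_filter.2 ⟨mem_componentOf.2 ((mem_componentOf.1 hu).trans hi.reachable),
    Or.inl ⟨i, rfl⟩⟩, hi⟩

/-- The graph induced on the component of `v`. -/
abbrev componentGraph (G : SimpleGraph (Fin n)) (v : Fin n) :
    SimpleGraph (componentOf G v) :=
  G.induce (componentOf G v : Set (Fin n))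

lemma componentGraph_connected (v : Fin n) : (componentGraph G v).Connected := by
  have h : (componentOf G v : Set (Fin n)) = (G.connectedComponentMk v).supp := by
    ext u
    simp [mem_componentOf, SimpleGraph.reachable_comm]
  have key : (G.induce (componentOf G v : Set (Fin n))).Connected :=
    h ▸ (G.connectedComponentMk v).connected_toSimpleGraph
  exact key

/-- The component of `v` contains a vertex of degree at least three. -/
def HasBranching (G : SimpleGraph (Fin n)) (v : Fin n) : Prop :=
  ∃ u x₁ x₂ x₃, G.Reachable v u ∧ x₁ ≠ x₂ ∧ x₁ ≠ x₃ ∧ x₂ ≠ x₃ ∧ G.Adj u x₁ ∧ G.Adj u x₂ ∧ G.Adj u x₃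

lemma isDominatingSet_subtype {v : Fin n} {D : Finset (Fin n)} (hD : DominatesComponent G v D) :
    IsDominatingSet (componentGraph G v) (D.subtype (· ∈ componentOf G v)) ∧
      (D.subtype (· ∈ componentOf G v)).card = D.card := by
  refine ⟨fun u hu => ?_, ?_⟩
  · obtain ⟨w, hw, huw⟩ := hD.2 u u.2 (fun h => hu (by simpa using h))
    exact ⟨⟨w, hD.1 hw⟩, by simpa using hw, huw⟩
  · rw [Finset.card_subtype, Finset.filter_true_of_mem hD.1]

theorem exists_componentCompletion_le (hG : G ∈ freeForkK3K2 n) {v : Fin n}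
    (hb : HasBranching G v) : ∃ a : Fin 15 → Fin n, ∀ D, DominatesComponent G v D →
      (componentCompletion G v a).card ≤ D.card := by
  classical
  obtain ⟨u, x₁, x₂, x₃, hu, h12, h13, h23, h1, h2, h3⟩ := hb
  have hsub : componentGraph G v ⊴ G := ⟨SimpleGraph.Embedding.induce _⟩
  have hm : ∀ {x}, G.Adj u x → x ∈ componentOf G v := fun h =>
    mem_componentOf.2 (hu.trans h.reachable)
  obtain ⟨A, hA, hAD⟩ := hasCore_of_three_le_degree (G := componentGraph G v)
    (fun h => hG.1 (h.trans hsub)) (fun h => hG.2 (h.trans hsub)) (componentGraph_connected v)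
    (v := ⟨u, mem_componentOf.2 hu⟩) (x₁ := ⟨x₁, hm h1⟩) (x₂ := ⟨x₂, hm h2⟩) (x₃ := ⟨x₃, hm h3⟩)
    (by simpa using h12) (by simpa using h13) (by simpa using h23) h1 h2 h3
  obtain ⟨a, ha⟩ : ∃ a : Fin 15 → Fin n, (componentCompletion G v a).card ≤
      (domCompletion (componentGraph G v) A).card := by
    rcases A.eq_empty_or_nonempty with rfl | ⟨a₀, ha₀⟩
    -- The completion of an empty core is the whole component, so any tuple will do.
    · refine ⟨fun _ => v, ?_⟩
      have : domCompletion (componentGraph G v) ∅ = Finset.univ := by ext; simp [mem_domCompletion]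
      rw [this, Finset.card_univ, Fintype.card_coe]
      exact Finset.card_le_card (Finset.filter_subset _ _)
    -- A core with fewer than fifteen vertices is padded by repeating `a₀`.
    · let f : Fin 15 → componentOf G v := fun i =>
        if h : i.1 < A.card then A.equivFin.symm ⟨i, h⟩ else a₀
      have hf : ∀ x, x ∈ A ↔ ∃ i, x = f i := by
        intro x
        constructor
        · intro hx
          refine ⟨⟨A.equivFin ⟨x, hx⟩, lt_of_lt_of_le (A.equivFin ⟨x, hx⟩).2 hA⟩, ?_⟩
          simp [f]
        · rintro ⟨i, rfl⟩
          by_cases h : i.1 < A.card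
          · simp [f, h]
          · simpa [f, h] using ha₀
      refine ⟨fun i => f i, ?_⟩
      rw [← Finset.card_map (Function.Embedding.subtype _)
        (s := domCompletion (componentGraph G v) A)]
      refine Finset.card_le_card fun x hx => ?_
      simp only [componentCompletion, Finset.mem_filter] at hx
      refine Finset.mem_map.2 ⟨⟨x, hx.1⟩, mem_domCompletion.2 ?_, rfl⟩
      rcases hx.2 with ⟨i, hi⟩ | h
      · exact Or.inl ((hf _).2 ⟨i, Subtype.ext hi⟩)
      · refine Or.inr fun w hw => ?_
        obtain ⟨i, rfl⟩ := (hf w).1 hw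
        exact h i
  refine ⟨a, fun D hD => ?_⟩
  obtain ⟨h, h'⟩ := isDominatingSet_subtype hD
  exact (ha.trans (hAD _ h)).trans h'.le

theorem isComponentDominationNumber_of_not_hasBranching {v : Fin n} (hb : ¬ HasBranching G v) :
    IsComponentDominationNumber G v (((componentOf G v).card + 2) / 3) := by
  classical
  have hdeg : ∀ u x₁ x₂ x₃ : componentOf G v, x₁ ≠ x₂ → x₁ ≠ x₃ → x₂ ≠ x₃ →
      (componentGraph G v).Adj u x₁ → (componentGraph G v).Adj u x₂ →
      ¬ (componentGraph G v).Adj u x₃ := by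
    intro u x₁ x₂ x₃ h12 h13 h23 h1 h2 h3
    exact hb ⟨u, x₁, x₂, x₃, mem_componentOf.1 u.2, fun h => h12 (Subtype.ext h),
      fun h => h13 (Subtype.ext h), fun h => h23 (Subtype.ext h), h1, h2, h3⟩
  constructor
  · obtain ⟨D, hD, hDc⟩ := exists_dominating_of_degree_le_two (componentGraph_connected v) hdeg
    refine ⟨D.map (Function.Embedding.subtype _), ⟨?_, ?_⟩, ?_⟩
    · intro x hx
      obtain ⟨y, -, rfl⟩ := Finset.mem_map.1 hx
      exact y.2
    · intro x hx hxD
      obtain ⟨w, hw, hxw⟩ := hD ⟨x, hx⟩ (fun h => hxD (Finset.mem_map.2 ⟨_, h, rfl⟩))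
      exact ⟨w, Finset.mem_map.2 ⟨_, hw, rfl⟩, hxw⟩
    · rw [Finset.card_map]
      simpa using hDc
  · intro D hD
    obtain ⟨h, h'⟩ := isDominatingSet_subtype hD
    have := card_le_three_mul_card_of_degree_le_two hdeg h
    rw [Fintype.card_coe] at this
    omega

end Components

/-! ### Programming the random access machine -/

section Ram

@[simp] lemma RamState.setReg_reg (s : RamState) (d v r : ℕ) :
    (s.setReg d v).reg r = if r = d then v else s.reg r := by
  simp [RamState.setReg, Function.update_apply]

@[simp] lemma RamState.setReg_mem (s : RamState) (d v : ℕ) : (s.setReg d v).mem = s.mem := rfl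

@[simp] lemma RamState.setMem_reg (s : RamState) (d v : ℕ) : (s.setMem d v).reg = s.reg := rfl

@[simp] lemma RamState.setMem_mem (s : RamState) (d v a : ℕ) :
    (s.setMem d v).mem a = if a = d then v else s.mem a := by
  simp [RamState.setMem, Function.update_apply]

/-- `P` takes the state `s` to `s'` in at most `T` steps. -/
def RamRunsWithin (P : RamProgram) (s s' : RamState) (T : ℕ) : Prop :=
  ∃ t ≤ T, RamRun P s s' t

lemma RamRun.within {P : RamProgram} {s s' : RamState} {t : ℕ} (h : RamRun P s s' t) :
    RamRunsWithin P s s' t := ⟨t, le_rfl, h⟩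

lemma RamRunsWithin.seq {P Q : RamProgram} {s s' s'' : RamState} {T T' : ℕ}
    (h : RamRunsWithin P s s' T) (h' : RamRunsWithin Q s' s'' T') :
    RamRunsWithin (.seq P Q) s s'' (T + T') := by
  obtain ⟨t, ht, h⟩ := h
  obtain ⟨t', ht', h'⟩ := h'
  exact ⟨t + t', by omega, .seq h h'⟩

lemma RamRunsWithin.mono {P : RamProgram} {s s' : RamState} {T T' : ℕ}
    (h : RamRunsWithin P s s' T) (hT : T ≤ T') : RamRunsWithin P s s' T' := by
  obtain ⟨t, ht, h⟩ := h
  exact ⟨t, by omega, h⟩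

/-- Run `c` once for each value `0, 1, …, n - 1` of register `a`, where `n` is the content of
register `0`. Registers `a + 1` and `a + 2` are used as well. -/
def forProgram (a : ℕ) (c : RamProgram) : RamProgram :=
  .seq (.set a 0) <| .seq (.set (a + 2) 0) <| .seq (.add (a + 1) 0 (a + 2)) <|
    .loop (a + 1) <| .seq c <| .seq (.set (a + 2) 1) <| .seq (.add a a (a + 2)) <|
      .sub (a + 1) (a + 1) (a + 2)

/-- Register `a` counts up while `a + 1` counts the remaining rounds, because a loop can only test
for zero. The invariant must ignore these control registers; the body may overwrite `a + 2`, which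
is reset each round. A round costs four steps beyond the body. -/
lemma forProgram_runs {a n T : ℕ} (ha : 0 < a) {c : RamProgram} {I : ℕ → RamState → Prop}
    (hI : ∀ i s s', s'.mem = s.mem → (∀ r, r < a ∨ a + 3 ≤ r → s'.reg r = s.reg r) →
      I i s → I i s')
    (hc : ∀ i < n, ∀ s, I i s → s.reg 0 = n → s.reg a = i →
      ∃ s', RamRunsWithin c s s' T ∧ I (i + 1) s' ∧ s'.reg 0 = n ∧ s'.reg a = i ∧
        s'.reg (a + 1) = s.reg (a + 1))
    {s : RamState} (hs : I 0 s) (hs0 : s.reg 0 = n) :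
    ∃ s', RamRunsWithin (forProgram a c) s s' (n * (T + 4) + 4) ∧ I n s' ∧ s'.reg 0 = n := by
  have hloop : ∀ m i s, i + m = n → I i s → s.reg 0 = n → s.reg a = i → s.reg (a + 1) = m →
      ∃ s', RamRunsWithin (.loop (a + 1) <| .seq c <| .seq (.set (a + 2) 1) <|
        .seq (.add a a (a + 2)) <| .sub (a + 1) (a + 1) (a + 2)) s s' (m * (T + 4) + 1) ∧
        I n s' ∧ s'.reg 0 = n := by
    intro m
    induction m with
    | zero =>
      intro i s hi h h0 _ hm
      obtain rfl : i = n := by omega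
      exact ⟨s, ((RamRun.loop_done hm).within).mono (by omega), h, h0⟩
    | succ m ih =>
      intro i s hi h h0 hsa hm
      obtain ⟨s₁, hr, h1, h10, h1a, h1m⟩ := hc i (by omega) s h h0 hsa
      obtain ⟨s₂, e, hm2, h2a, h2m, h2r⟩ : ∃ s₂, RamRun (.seq (.set (a + 2) 1) <|
          .seq (.add a a (a + 2)) <| .sub (a + 1) (a + 1) (a + 2)) s₁ s₂ (1 + (1 + 1)) ∧
          s₂.mem = s₁.mem ∧ s₂.reg a = i + 1 ∧ s₂.reg (a + 1) = m ∧
          ∀ r, r < a ∨ a + 3 ≤ r → s₂.reg r = s₁.reg r := by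
        refine ⟨_, (RamRun.set _ _ _).seq ((RamRun.add _ _ _ _).seq (RamRun.sub _ _ _ _)),
          by simp, by simp [h1a], by simp [h1m, hm], ?_⟩
        intro r hr
        simp [show r ≠ a by omega, show r ≠ a + 1 by omega, show r ≠ a + 2 by omega]
      obtain ⟨s', hr', h', h0'⟩ := ih (i + 1) s₂ (by omega) (hI (i + 1) s₁ s₂ hm2 h2r h1)
        ((h2r 0 (Or.inl ha)).trans h10) h2a h2m
      obtain ⟨t, ht, hr⟩ := hr
      obtain ⟨t', ht', hr'⟩ := hr'
      refine ⟨s', ⟨_, ?_, RamRun.loop_step (by omega) (hr.seq e) hr'⟩, h', h0'⟩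
      have : (m + 1) * (T + 4) = m * (T + 4) + (T + 4) := by ring
      omega
  set s₁ := ((s.setReg a 0).setReg (a + 2) 0).setReg (a + 1)
    (((s.setReg a 0).setReg (a + 2) 0).reg 0 + ((s.setReg a 0).setReg (a + 2) 0).reg (a + 2))
    with hs₁
  have hr₁ : ∀ r, r < a ∨ a + 3 ≤ r → s₁.reg r = s.reg r := by
    intro r hr
    simp [hs₁, show r ≠ a by omega, show r ≠ a + 1 by omega, show r ≠ a + 2 by omega]
  obtain ⟨s', hr', h', h0'⟩ := hloop n 0 s₁ (by omega) (hI 0 s s₁ (by simp [hs₁]) hr₁ hs)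
    ((hr₁ 0 (Or.inl ha)).trans hs0) (by simp [hs₁])
    (by simp [hs₁, show (0 : ℕ) ≠ a by omega, hs0])
  exact ⟨s', ((RamRun.set _ _ _).within.seq ((RamRun.set _ _ _).within.seq
    ((RamRun.add _ _ _ _).within.seq hr'))).mono (by omega), h', h0'⟩

/-- Arithmetic terms with bounded sums, over the size `n` of the input and the memory. -/
inductive RamTerm : Type
  | var (x : ℕ) : RamTerm
  | const (c : ℕ) : RamTerm
  | size : RamTerm
  | add (t u : RamTerm) : RamTerm
  | sub (t u : RamTerm) : RamTerm
  | load (t : RamTerm) : RamTerm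
  | ite (t u w : RamTerm) : RamTerm
  /-- the sum of the values of `t` for the values `0, …, n - 1` of the variable `x` -/
  | sum (x : ℕ) (t : RamTerm) : RamTerm

/-! ### Evaluation and compilation of terms. -/

namespace RamTerm

/-- The value of a term, for the size `n`, the memory `μ` and the values `ρ` of the variables. -/
def eval (n : ℕ) (μ : ℕ → ℕ) : RamTerm → (ℕ → ℕ) → ℕ
  | var x, ρ => ρ x
  | const c, _ => c
  | size, _ => n
  | add t u, ρ => t.eval n μ ρ + u.eval n μ ρ
  | sub t u, ρ => t.eval n μ ρ - u.eval n μ ρ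
  | load t, ρ => μ (t.eval n μ ρ)
  | ite t u w, ρ => if t.eval n μ ρ ≠ 0 then u.eval n μ ρ else w.eval n μ ρ
  | sum x t, ρ => ∑ i ∈ Finset.range n, t.eval n μ (Function.update ρ x i)

/-- All variables of the term are below this number. -/
def bound : RamTerm → ℕ
  | var x => x + 1
  | const _ => 0
  | size => 0
  | add t u => max t.bound u.bound
  | sub t u => max t.bound u.bound
  | load t => t.bound
  | ite t u w => max t.bound (max u.bound w.bound)
  | sum x t => max (x + 1) t.bound

/-- A program that evaluates the term into register `d`. The variable `x` is in register `x + 2`,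
and registers below `d` are left as they are. -/
def compile : RamTerm → ℕ → RamProgram
  | var x, d => .seq (.set d 0) (.add d (x + 2) d)
  | const c, d => .set d c
  | size, d => .seq (.set d 0) (.add d 0 d)
  | add t u, d => .seq (t.compile d) (.seq (u.compile (d + 1)) (.add d d (d + 1)))
  | sub t u, d => .seq (t.compile d) (.seq (u.compile (d + 1)) (.sub d d (d + 1)))
  | load t, d => .seq (t.compile d) (.load d d)
  | ite t u w, d => .seq (t.compile d) (.ite d (u.compile d) (w.compile d))
  | sum x t, d =>
    .seq (.set d 0) <| .seq (.add (d + 1) (x + 2) d) <|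
      .seq (forProgram (d + 2) <| .seq (.set (d + 5) 0) <| .seq (.add (x + 2) (d + 2) (d + 5)) <|
        .seq (t.compile (d + 5)) (.add d d (d + 5))) <|
      .seq (.set (d + 2) 0) (.add (x + 2) (d + 1) (d + 2))

/-- A bound for the time that the evaluation takes. -/
noncomputable def cost : RamTerm → Polynomial ℕ
  | var _ => 2
  | const _ => 1
  | size => 2
  | add t u => t.cost + u.cost + 1
  | sub t u => t.cost + u.cost + 1
  | load t => t.cost + 1
  | ite t u w => t.cost + u.cost + w.cost + 1
  | sum _ t => Polynomial.X * (t.cost + 7) + 8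

lemma eval_congr {n : ℕ} {μ : ℕ → ℕ} (t : RamTerm) {ρ ρ' : ℕ → ℕ}
    (h : ∀ x < t.bound, ρ x = ρ' x) : t.eval n μ ρ = t.eval n μ ρ' := by
  induction t generalizing ρ ρ' with
  | var x => exact h x (by simp [bound])
  | const c => rfl
  | size => rfl
  | add t u iht ihu =>
    simp only [eval]
    rw [iht fun x hx => h x (by simp [bound, hx]), ihu fun x hx => h x (by simp [bound, hx])]
  | sub t u iht ihu =>
    simp only [eval]
    rw [iht fun x hx => h x (by simp [bound, hx]), ihu fun x hx => h x (by simp [bound, hx])]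
  | load t iht =>
    simp only [eval]
    rw [iht fun x hx => h x (by simp [bound, hx])]
  | ite t u w iht ihu ihw =>
    simp only [eval]
    rw [iht fun x hx => h x (by simp [bound, hx]), ihu fun x hx => h x (by simp [bound, hx]),
      ihw fun x hx => h x (by simp [bound, hx])]
  | sum y t iht =>
    simp only [eval]
    refine Finset.sum_congr rfl fun i _ => iht fun x hx => ?_
    by_cases hxy : x = y
    · simp [hxy]
    · simp [Function.update_of_ne hxy, h x (by simp [bound, hx])]

/-- All registers of variables lie below `d`, so intermediate results do not disturb them. A sum
accumulates in `d`, keeps the old value of its variable in `d + 1`, runs the loop on `d + 2` to `d +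
4` and evaluates its body from `d + 5` on. -/
theorem compile_runs (t : RamTerm) {n d : ℕ} (hd : t.bound + 2 ≤ d) {s : RamState}
    (hs : s.reg 0 = n) :
    ∃ s', RamRunsWithin (t.compile d) s s' (t.cost.eval n) ∧ s'.mem = s.mem ∧
      (∀ r < d, s'.reg r = s.reg r) ∧ s'.reg d = t.eval n s.mem fun x => s.reg (x + 2) := by
  induction t generalizing d s with
  | var x =>
    simp only [bound] at hd
    refine ⟨_, ((RamRun.set d 0 s).seq (RamRun.add d (x + 2) d _)).within.mono (by simp [cost]),
      by simp, ?_, ?_⟩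
    · intro r hr
      simp [hr.ne]
    · simp [eval, show x + 2 ≠ d by omega]
  | const c =>
    refine ⟨_, (RamRun.set d c s).within.mono (by simp [cost]), by simp, ?_, by simp [eval]⟩
    intro r hr
    simp [hr.ne]
  | size =>
    refine ⟨_, ((RamRun.set d 0 s).seq (RamRun.add d 0 d _)).within.mono (by simp [cost]),
      by simp, ?_, ?_⟩
    · intro r hr
      simp [hr.ne]
    · simp [eval, show 0 ≠ d by omega, hs]
  | add t u iht ihu =>
    simp only [bound] at hd
    obtain ⟨s₁, h1, m1, r1, v1⟩ := iht (d := d) (by omega) hs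
    obtain ⟨s₂, h2, m2, r2, v2⟩ := ihu (d := d + 1) (by omega) ((r1 0 (by omega)).trans hs)
    refine ⟨_, (h1.seq (h2.seq (RamRun.add d d (d + 1) s₂).within)).mono
      (by simp [cost, add_assoc]), by simp [m1, m2], ?_, ?_⟩
    · intro r hr
      simp [hr.ne, r2 r (by omega), r1 r hr]
    · have e : (u.eval n s₁.mem fun x => s₁.reg (x + 2)) = u.eval n s.mem fun x => s.reg (x + 2) :=
        m1 ▸ u.eval_congr fun x hx => r1 _ (by omega)
      simp [eval, v2, r2 d (by omega), v1, e]
  | sub t u iht ihu =>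
    simp only [bound] at hd
    obtain ⟨s₁, h1, m1, r1, v1⟩ := iht (d := d) (by omega) hs
    obtain ⟨s₂, h2, m2, r2, v2⟩ := ihu (d := d + 1) (by omega) ((r1 0 (by omega)).trans hs)
    refine ⟨_, (h1.seq (h2.seq (RamRun.sub d d (d + 1) s₂).within)).mono
      (by simp [cost, add_assoc]), by simp [m1, m2], ?_, ?_⟩
    · intro r hr
      simp [hr.ne, r2 r (by omega), r1 r hr]
    · have e : (u.eval n s₁.mem fun x => s₁.reg (x + 2)) = u.eval n s.mem fun x => s.reg (x + 2) :=
        m1 ▸ u.eval_congr fun x hx => r1 _ (by omega)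
      simp [eval, v2, r2 d (by omega), v1, e]
  | load t iht =>
    simp only [bound] at hd
    obtain ⟨s₁, h1, m1, r1, v1⟩ := iht (d := d) (by omega) hs
    refine ⟨_, (h1.seq (RamRun.load d d s₁).within).mono (by simp [cost]), by simp [m1], ?_, ?_⟩
    · intro r hr
      simp [hr.ne, r1 r hr]
    · simp [eval, v1, m1]
  | ite t u w iht ihu ihw =>
    simp only [bound] at hd
    obtain ⟨s₁, h1, m1, r1, v1⟩ := iht (d := d) (by omega) hs
    have hs1 := (r1 0 (by omega)).trans hs
    by_cases hv : s₁.reg d = 0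
    · obtain ⟨s₂, ⟨t₂, ht₂, h2⟩, m2, r2, v2⟩ := ihw (d := d) (by omega) hs1
      refine ⟨s₂, (h1.seq (RamRun.ite_false hv h2).within).mono ?_, m2.trans m1, ?_, ?_⟩
      · simp only [cost, Polynomial.eval_add, Polynomial.eval_one]
        omega
      · exact fun r hr => (r2 r hr).trans (r1 r hr)
      · rw [v2, m1, w.eval_congr (ρ := fun x => s₁.reg (x + 2)) fun x hx => r1 _ (by omega)]
        simp [eval, ← v1, hv]
    · obtain ⟨s₂, ⟨t₂, ht₂, h2⟩, m2, r2, v2⟩ := ihu (d := d) (by omega) hs1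
      refine ⟨s₂, (h1.seq (RamRun.ite_true hv h2).within).mono ?_, m2.trans m1, ?_, ?_⟩
      · simp only [cost, Polynomial.eval_add, Polynomial.eval_one]
        omega
      · exact fun r hr => (r2 r hr).trans (r1 r hr)
      · rw [v2, m1, u.eval_congr (ρ := fun x => s₁.reg (x + 2)) fun x hx => r1 _ (by omega)]
        simp [eval, ← v1, hv]
  | sum x t iht =>
    simp only [bound] at hd
    set ρ : ℕ → ℕ := fun x => s.reg (x + 2) with hρ
    have e1 := RamRun.set d 0 s
    have e2 := RamRun.add (d + 1) (x + 2) d (s.setReg d 0)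
    obtain ⟨s₁, hr, ⟨m1, r1, sv, acc⟩, h10⟩ := forProgram_runs (a := d + 2) (n := n)
      (T := t.cost.eval n + 3) (by omega)
      (c := .seq (.set (d + 5) 0) <| .seq (.add (x + 2) (d + 2) (d + 5)) <|
        .seq (t.compile (d + 5)) (.add d d (d + 5)))
      -- The register of the bound variable is exempt during the loop; it is restored from `d + 1`
      -- afterwards.
      (I := fun i s' => s'.mem = s.mem ∧ (∀ r < d, r ≠ x + 2 → s'.reg r = s.reg r) ∧
        s'.reg (d + 1) = s.reg (x + 2) ∧
        s'.reg d = ∑ j ∈ Finset.range i, t.eval n s.mem (Function.update ρ x j))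
      (by
        rintro i s₁ s₂ hm hr ⟨h1, h2, h3, h4⟩
        refine ⟨hm.trans h1, fun r hrd hrx => (hr r (by omega)).trans (h2 r hrd hrx),
          (hr _ (by omega)).trans h3, (hr _ (by omega)).trans h4⟩)
      (by
        rintro i hi s₁ ⟨h1, h2, h3, h4⟩ h0 ha
        have f1 := RamRun.set (d + 5) 0 s₁
        have f2 := RamRun.add (x + 2) (d + 2) (d + 5) (s₁.setReg (d + 5) 0)
        set s₂ := (s₁.setReg (d + 5) 0).setReg (x + 2)
          ((s₁.setReg (d + 5) 0).reg (d + 2) + (s₁.setReg (d + 5) 0).reg (d + 5)) with hs₂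
        have g : ∀ r, r < d + 5 → s₂.reg r = if r = x + 2 then i else s₁.reg r := by
          intro r hr
          simp [hs₂, ha, show r ≠ d + 5 by omega]
        obtain ⟨s₃, f3, m3, r3, v3⟩ := iht (d := d + 5) (s := s₂) (by omega)
          (by rw [g 0 (by omega)]; simp [h0])
        have f4 := RamRun.add d d (d + 5) s₃
        have hm2 : s₂.mem = s.mem := by simp [hs₂, h1]
        have v3' : s₃.reg (d + 5) = t.eval n s.mem (Function.update ρ x i) := by
          rw [v3, hm2]
          refine t.eval_congr fun y hy => ?_
          rw [g (y + 2) (by omega)]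
          by_cases hyx : y = x
          · simp [hyx]
          · rw [Function.update_of_ne hyx, if_neg (by omega), h2 _ (by omega) (by omega)]
        have g3 : ∀ r, r < d + 5 → r ≠ x + 2 → s₃.reg r = s₁.reg r := by
          intro r hr hrx
          rw [r3 r hr, g r hr, if_neg hrx]
        refine ⟨_, (f1.within.seq (f2.within.seq (f3.seq f4.within))).mono (by omega),
          ⟨by simp [m3, hm2], ?_, ?_, ?_⟩, ?_, ?_, ?_⟩
        · intro r hrd hrx
          simp only [RamState.setReg_reg, hrd.ne, if_false]
          rw [g3 r (by omega) hrx, h2 r hrd hrx]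
        · simp only [RamState.setReg_reg, show d + 1 ≠ d by omega, if_false]
          rw [g3 _ (by omega) (by omega), h3]
        · simp only [RamState.setReg_reg, if_true]
          rw [g3 _ (by omega) (by omega), h4, v3', Finset.sum_range_succ]
        · simp only [RamState.setReg_reg, show 0 ≠ d by omega, if_false]
          rw [g3 _ (by omega) (by omega), h0]
        · simp only [RamState.setReg_reg, show d + 2 ≠ d by omega, if_false]
          rw [g3 _ (by omega) (by omega), ha]
        · simp only [RamState.setReg_reg, show d + 2 + 1 ≠ d by omega, if_false]
          rw [g3 _ (by omega) (by omega)])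
      (s := (s.setReg d 0).setReg (d + 1) ((s.setReg d 0).reg (x + 2) + (s.setReg d 0).reg d))
      (by
        refine ⟨by simp, ?_, ?_, by simp⟩
        · intro r hr _
          simp [hr.ne, show r ≠ d + 1 by omega]
        · simp [show x + 2 ≠ d by omega])
      (by simp [show 0 ≠ d by omega, hs])
    have e3 := RamRun.set (d + 2) 0 s₁
    have e4 := RamRun.add (x + 2) (d + 1) (d + 2) (s₁.setReg (d + 2) 0)
    refine ⟨_, (e1.within.seq (e2.within.seq (hr.seq (e3.within.seq e4.within)))).mono ?_,
      by simp [m1], ?_, ?_⟩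
    · simp only [cost, Polynomial.eval_add, Polynomial.eval_mul, Polynomial.eval_X,
        Polynomial.eval_ofNat]
      rw [show t.cost.eval n + 3 + 4 = t.cost.eval n + 7 by ring]
      omega
    · intro r hr
      by_cases hrx : r = x + 2
      · simp [hrx, sv]
      · simp [hrx, show r ≠ d + 2 by omega, r1 r hr hrx]
    · simp [show d ≠ x + 2 by omega, acc, eval]

end RamTerm

/-- Write the value of the second term into the memory cell addressed by the first one. -/
def storeProgram (d : ℕ) (t u : RamTerm) : RamProgram :=
  .seq (t.compile d) (.seq (u.compile (d + 1)) (.store d (d + 1)))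

lemma storeProgram_runs {t u : RamTerm} {n d : ℕ} (ht : t.bound + 2 ≤ d) (hu : u.bound + 2 ≤ d)
    {s : RamState} (hs : s.reg 0 = n) :
    ∃ s', RamRunsWithin (storeProgram d t u) s s' (t.cost.eval n + u.cost.eval n + 1) ∧
      s'.mem = Function.update s.mem (t.eval n s.mem fun x => s.reg (x + 2))
        (u.eval n s.mem fun x => s.reg (x + 2)) ∧ ∀ r < d, s'.reg r = s.reg r := by
  obtain ⟨s₁, h1, m1, r1, v1⟩ := t.compile_runs ht hs
  obtain ⟨s₂, h2, m2, r2, v2⟩ :=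
    u.compile_runs (d := d + 1) (by omega) ((r1 0 (by omega)).trans hs)
  refine ⟨_, (h1.seq (h2.seq (RamRun.store d (d + 1) s₂).within)).mono (by omega), ?_, ?_⟩
  · have e : (u.eval n s₁.mem fun x => s₁.reg (x + 2)) = u.eval n s.mem fun x => s.reg (x + 2) :=
      m1 ▸ u.eval_congr fun x hx => r1 _ (by omega)
    simp [RamState.setMem, m2, v2, r2 d (by omega), v1, e]
    simp [m1]
  · intro r hr
    simp [r2 r (by omega), r1 r hr]

end Ram

/-! ### Terms for properties of graphs -/

namespace RamTerm

/-- The term has a nonzero value. -/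
def Holds (n : ℕ) (μ : ℕ → ℕ) (t : RamTerm) (ρ : ℕ → ℕ) : Prop := t.eval n μ ρ ≠ 0

/-- Conjunction. -/
def and (t u : RamTerm) : RamTerm := ite t u (const 0)

/-- Disjunction. -/
def or (t u : RamTerm) : RamTerm := ite t (const 1) u

/-- Negation. -/
def not (t : RamTerm) : RamTerm := ite t (const 0) (const 1)

/-- Equality. -/
def eq (t u : RamTerm) : RamTerm := not (or (sub t u) (sub u t))

/-- The number of values of the variable `x` for which `t` holds. -/
def count (x : ℕ) (t : RamTerm) : RamTerm := sum x (ite t (const 1) (const 0))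

/-- Disjunction of the first `m` terms of a sequence. -/
def anyBelow : ℕ → (ℕ → RamTerm) → RamTerm
  | 0, _ => const 0
  | m + 1, f => or (f m) (anyBelow m f)

/-- Existential quantification over the variables `20, …, 20 + m - 1`. -/
def exTuple : ℕ → RamTerm → RamTerm
  | 0, t => t
  | m + 1, t => sum (20 + m) (exTuple m t)

/-- The entry of the adjacency matrix at the variables `x` and `y`. -/
def adj (x y : ℕ) : RamTerm := load (add (sum 14 (var x)) (var y))

/-- The entry at the variables `x` and `y` of the matrix written after the adjacency matrix. -/
def reach (x y : ℕ) : RamTerm := load (add (sum 14 size) (add (sum 14 (var x)) (var y)))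

variable {n : ℕ} {μ : ℕ → ℕ} {t u : RamTerm} {ρ : ℕ → ℕ}

@[simp] lemma holds_and : Holds n μ (and t u) ρ ↔ Holds n μ t ρ ∧ Holds n μ u ρ := by
  by_cases h : t.eval n μ ρ = 0 <;> simp [Holds, and, eval, h]

@[simp] lemma holds_or : Holds n μ (or t u) ρ ↔ Holds n μ t ρ ∨ Holds n μ u ρ := by
  by_cases h : t.eval n μ ρ = 0 <;> simp [Holds, or, eval, h]

@[simp] lemma holds_not : Holds n μ (not t) ρ ↔ ¬ Holds n μ t ρ := by
  by_cases h : t.eval n μ ρ = 0 <;> simp [Holds, not, eval, h]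

@[simp] lemma holds_sub : Holds n μ (sub t u) ρ ↔ u.eval n μ ρ < t.eval n μ ρ := by
  simp only [Holds, eval]
  omega

@[simp] lemma holds_eq : Holds n μ (eq t u) ρ ↔ t.eval n μ ρ = u.eval n μ ρ := by
  simp only [eq, holds_not, holds_or, holds_sub]
  omega

@[simp] lemma holds_sum {x : ℕ} :
    Holds n μ (sum x t) ρ ↔ ∃ i : Fin n, Holds n μ t (Function.update ρ x i) := by
  simp [Holds, eval, Finset.sum_eq_zero_iff, Fin.exists_iff]

@[simp] lemma holds_anyBelow {m : ℕ} {f : ℕ → RamTerm} :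
    Holds n μ (anyBelow m f) ρ ↔ ∃ i : Fin m, Holds n μ (f i) ρ := by
  induction m with
  | zero => simp [anyBelow, Holds, eval]
  | succ m ih =>
    rw [anyBelow, holds_or, ih, or_comm]
    simp only [Fin.exists_iff, exists_prop, Nat.exists_lt_succ_right]

/-- The tuple appears as an assignment that differs from `ρ` only at the quantified variables. The
depth `m` of the nested sums is fixed in the term, so the cost remains polynomial. -/
lemma holds_exTuple {m : ℕ} : Holds n μ (exTuple m t) ρ ↔ ∃ ρ' : ℕ → ℕ,
    (∀ x, x < 20 ∨ 20 + m ≤ x → ρ' x = ρ x) ∧ (∀ i < m, ρ' (20 + i) < n) ∧ Holds n μ t ρ' := by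
  induction m generalizing ρ with
  | zero =>
    refine ⟨fun h => ⟨ρ, by simp, by simp, h⟩, ?_⟩
    rintro ⟨ρ', h, -, h'⟩
    obtain rfl : ρ' = ρ := funext fun x => h x (by omega)
    exact h'
  | succ m ih =>
    simp only [exTuple, holds_sum, ih]
    constructor
    · rintro ⟨i, ρ', h1, h2, h3⟩
      refine ⟨ρ', fun x hx => ?_, fun j hj => ?_, h3⟩
      · rw [h1 x (by omega), Function.update_of_ne (by omega)]
      · by_cases hjm : j = m
        · rw [h1 _ (by omega), hjm]
          simp
        · exact h2 j (by omega)
    · rintro ⟨ρ', h1, h2, h3⟩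
      refine ⟨⟨ρ' (20 + m), h2 m (by omega)⟩, ρ', fun x hx => ?_, fun j hj => h2 j (by omega), h3⟩
      by_cases hxm : x = 20 + m
      · simp [hxm]
      · rw [Function.update_of_ne hxm, h1 x (by omega)]

open Classical in
lemma eval_count {x : ℕ} : (count x t).eval n μ ρ =
    (Finset.univ.filter fun i : Fin n => Holds n μ t (Function.update ρ x i)).card := by
  rw [Finset.card_filter, count, eval, Finset.sum_range]
  exact Finset.sum_congr rfl fun i _ => by
    simp only [eval]
    exact if_congr Iff.rfl rfl rfl

/-- Multiplication by `n` is expressed as a sum of `n` equal terms over the dummy variable 14, which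
`x` must therefore avoid. -/
lemma eval_adj {x y : ℕ} (hx : x ≠ 14) : (adj x y).eval n μ ρ = μ (ρ x * n + ρ y) := by
  simp [adj, eval, hx, mul_comm]

lemma eval_reach {x y : ℕ} (hx : x ≠ 14) :
    (reach x y).eval n μ ρ = μ (n * n + (ρ x * n + ρ y)) := by
  simp [reach, eval, hx, mul_comm]

end RamTerm

/-! ### Reachability -/

section Reachability

variable {n : ℕ} {G : SimpleGraph (Fin n)}

/-- There is a walk of length less than `j` from `u` to `v`. -/
def ReachableWithin (G : SimpleGraph (Fin n)) : ℕ → Fin n → Fin n → Prop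
  | 0, _, _ => False
  | j + 1, u, v => u = v ∨ ∃ w, G.Adj u w ∧ ReachableWithin G j w v

lemma reachableWithin_of_walk {u v : Fin n} (p : G.Walk u v) {j : ℕ} (hj : p.length < j) :
    ReachableWithin G j u v := by
  induction p generalizing j with
  | nil =>
    obtain ⟨j, rfl⟩ := Nat.exists_eq_add_of_lt hj
    exact Or.inl rfl
  | cons h p ih =>
    rw [SimpleGraph.Walk.length_cons] at hj
    obtain ⟨j, rfl⟩ : ∃ i, j = i + 1 := ⟨j - 1, by omega⟩
    exact Or.inr ⟨_, h, ih (by omega)⟩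

/-- A path repeats no vertex, so its length is below `n`; thus `n` rounds suffice. -/
lemma SimpleGraph.Reachable.reachableWithin {u v : Fin n} (h : G.Reachable u v) :
    ReachableWithin G n u v := by
  classical
  obtain ⟨p⟩ := h
  refine reachableWithin_of_walk (p.toPath : G.Walk u v) ?_
  simpa using p.toPath.2.length_lt

/-- The first `n * n` memory cells hold the adjacency matrix of `G`. -/
def HoldsAdjacency (G : SimpleGraph (Fin n)) (μ : ℕ → ℕ) : Prop :=
  ∀ u v : Fin n, μ (u * n + v) ≠ 0 ↔ G.Adj u v

/-- The nonzero entries of the second matrix are at pairs of vertices in the same component, and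
they include the pairs connected by a walk of length less than `j`, as well as those connected by
a walk of length at most `j` that come before `(i, l)` in the lexicographic order. -/
structure ReachInvariant (G : SimpleGraph (Fin n)) (j i l : ℕ) (μ : ℕ → ℕ) : Prop where
  adj : HoldsAdjacency G μ
  sound : ∀ u v : Fin n, μ (n * n + (u * n + v)) ≠ 0 → G.Reachable u v
  prev : ∀ u v : Fin n, ReachableWithin G j u v → μ (n * n + (u * n + v)) ≠ 0
  next : ∀ u v : Fin n, (u : ℕ) < i ∨ (u : ℕ) = i ∧ (v : ℕ) < l → ReachableWithin G (j + 1) u v →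
    μ (n * n + (u * n + v)) ≠ 0

open RamTerm in
/-- The address of the entry at the variables `3` and `6` of the second matrix. -/
def reachAddress : RamTerm := add (sum 14 size) (add (sum 14 (var 3)) (var 6))

open RamTerm in
/-- Is the vertex `3` equal to the vertex `6`, or does it have a neighbor connected to it? -/
def reachUpdate : RamTerm :=
  or (eq (var 3) (var 6)) (or (reach 3 6) (sum 10 (and (adj 3 10) (reach 10 6))))

/-- A program that computes the connected components. -/
def reachProgram : RamProgram :=
  forProgram 2 (forProgram 5 (forProgram 8 (storeProgram 20 reachAddress reachUpdate)))

lemma mul_add_inj {a b c d : ℕ} (hb : b < n) (hd : d < n) (h : a * n + b = c * n + d) :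
    a = c ∧ b = d := by
  have h1 := congrArg (· % n) h
  simp only [Nat.mul_add_mod', Nat.mod_eq_of_lt hb, Nat.mod_eq_of_lt hd] at h1
  subst h1
  exact ⟨Nat.eq_of_mul_eq_mul_right (by omega) (Nat.add_right_cancel h), rfl⟩

lemma mul_add_lt {a b : ℕ} (ha : a < n) (hb : b < n) : a * n + b < n * n := by
  have : (a + 1) * n ≤ n * n := Nat.mul_le_mul_right n ha
  rw [add_mul, one_mul] at this
  omega

/-- The matrix is updated in place, so a round may already use its own new entries. This is
harmless: soundness asks only for reachability, and nonzero entries stay nonzero. -/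
lemma ReachInvariant.update {j : ℕ} {i l : Fin n} {μ ρ : ℕ → ℕ}
    (h : ReachInvariant G j i l μ) (hi : ρ 3 = i) (hl : ρ 6 = l) :
    ReachInvariant G j i (l + 1)
      (Function.update μ (reachAddress.eval n μ ρ) (reachUpdate.eval n μ ρ)) := by
  have ha : reachAddress.eval n μ ρ = n * n + (i * n + l) := by
    simp [reachAddress, RamTerm.eval, hi, hl, mul_comm]
  have hv : reachUpdate.eval n μ ρ ≠ 0 ↔ i = l ∨ μ (n * n + (i * n + l)) ≠ 0 ∨
      ∃ w : Fin n, G.Adj i w ∧ μ (n * n + (w * n + l)) ≠ 0 := by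
    have hadj : ∀ u v : Fin n, μ (u * n + v) ≠ 0 ↔ G.Adj u v := h.adj
    change RamTerm.Holds n μ reachUpdate ρ ↔ _
    simp only [reachUpdate, RamTerm.holds_or, RamTerm.holds_eq, RamTerm.holds_sum,
      RamTerm.holds_and]
    simp [RamTerm.Holds, RamTerm.eval_adj, RamTerm.eval_reach, RamTerm.eval, hi, hl, ← hadj,
      Fin.ext_iff]
  rw [ha]
  generalize reachUpdate.eval n μ ρ = x at hv
  have old : ∀ u v : Fin n, μ (n * n + (u * n + v)) ≠ 0 →
      Function.update μ (n * n + (i * n + l)) x (n * n + (u * n + v)) ≠ 0 := by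
    intro u v huv
    by_cases he : (u : ℕ) * n + v = i * n + l
    · rw [he] at huv ⊢
      rw [Function.update_self]
      exact hv.2 (Or.inr (Or.inl huv))
    · rwa [Function.update_of_ne (by omega)]
  refine ⟨fun u v => ?_, fun u v huv => ?_, fun u v huv => old u v (h.prev u v huv),
    fun u v huv hr => ?_⟩
  · have := mul_add_lt u.2 v.2
    rw [Function.update_of_ne (by omega)]
    exact h.adj u v
  · by_cases he : (u : ℕ) * n + v = i * n + l
    · obtain ⟨e1, e2⟩ := mul_add_inj v.2 l.2 he
      obtain rfl := Fin.ext e1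
      obtain rfl := Fin.ext e2
      rw [Function.update_self, hv] at huv
      rcases huv with rfl | h' | ⟨w, hw, hwl⟩
      · exact SimpleGraph.Reachable.refl _
      · exact h.sound _ _ h'
      · exact hw.reachable.trans (h.sound _ _ hwl)
    · rw [Function.update_of_ne (by omega)] at huv
      exact h.sound u v huv
  · by_cases he : (u : ℕ) = i ∧ (v : ℕ) = l
    · obtain rfl := Fin.ext he.1
      obtain rfl := Fin.ext he.2
      rw [Function.update_self, hv]
      rcases hr with rfl | ⟨w, hw, hwl⟩
      · exact Or.inl rfl
      · exact Or.inr (Or.inr ⟨w, hw, h.prev _ _ hwl⟩)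
    · exact old u v (h.next u v (by omega) hr)

/-- A bound for the running time of the computation of the components. -/
noncomputable def reachCost : Polynomial ℕ :=
  .X * (.X * (.X * (reachAddress.cost + reachUpdate.cost + 5) + 8) + 8) + 4

/-- The counters of the two inner loops, registers 5 and 8, are the variables 3 and 6 of the terms.
Each outer round completes the `next` part of the invariant, which becomes `prev` for the following
round. -/
lemma reachProgram_runs {s : RamState} (hs : s.reg 0 = n) (hG : HoldsAdjacency G s.mem)
    (h0 : ∀ a, n * n ≤ a → s.mem a = 0) :
    ∃ s', RamRunsWithin reachProgram s s' (reachCost.eval n) ∧ s'.reg 0 = n ∧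
      s'.reg 1 = s.reg 1 ∧ HoldsAdjacency G s'.mem ∧
      ∀ u v : Fin n, s'.mem (n * n + (u * n + v)) ≠ 0 ↔ G.Reachable u v := by
  set T := reachAddress.cost.eval n + reachUpdate.cost.eval n + 1 with hT
  have inner : ∀ j i, i < n → ∀ s : RamState, s.reg 0 = n → s.reg 5 = i →
      ReachInvariant G j i 0 s.mem →
      ∃ s', RamRunsWithin (forProgram 8 (storeProgram 20 reachAddress reachUpdate)) s s'
        (n * (T + 4) + 4) ∧ ReachInvariant G j i n s'.mem ∧ ∀ r < 8, s'.reg r = s.reg r := by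
    intro j i hi s hs0 hs5 hs
    obtain ⟨s', hr, ⟨h1, h2⟩, -⟩ := forProgram_runs (a := 8) (by norm_num)
      (I := fun l s' => ReachInvariant G j i l s'.mem ∧ ∀ r < 8, s'.reg r = s.reg r)
      (n := n) (T := T) (c := storeProgram 20 reachAddress reachUpdate)
      (by
        rintro l s₁ s₂ hm hr ⟨h1, h2⟩
        exact ⟨hm ▸ h1, fun r hr' => (hr r (Or.inl hr')).trans (h2 r hr')⟩)
      (by
        rintro l hl s₁ ⟨h1, h2⟩ h10 h18
        obtain ⟨s₂, hr, hm, hr'⟩ := storeProgram_runs (t := reachAddress) (u := reachUpdate)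
          (d := 20) (by decide) (by decide) h10
        refine ⟨s₂, hr, ⟨?_, fun r hr => (hr' r (by omega)).trans (h2 r hr)⟩,
          (hr' 0 (by norm_num)).trans h10, (hr' 8 (by norm_num)).trans h18, hr' 9 (by norm_num)⟩
        rw [hm]
        exact ReachInvariant.update (i := ⟨i, hi⟩) (l := ⟨l, hl⟩) h1 ((h2 5 (by norm_num)).trans hs5)
          h18)
      (s := s) ⟨hs, fun _ _ => rfl⟩ hs0
    exact ⟨s', hr, h1, h2⟩
  have middle : ∀ j, ∀ s : RamState, s.reg 0 = n → ReachInvariant G j 0 0 s.mem →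
      ∃ s', RamRunsWithin (forProgram 5 (forProgram 8 (storeProgram 20 reachAddress reachUpdate)))
        s s' (n * (n * (T + 4) + 4 + 4) + 4) ∧ ReachInvariant G j n 0 s'.mem ∧
        ∀ r < 5, s'.reg r = s.reg r := by
    intro j s hs0 hs
    obtain ⟨s', hr, ⟨h1, h2⟩, -⟩ := forProgram_runs (a := 5) (by norm_num)
      (I := fun i s' => ReachInvariant G j i 0 s'.mem ∧ ∀ r < 5, s'.reg r = s.reg r)
      (n := n) (T := n * (T + 4) + 4)
      (c := forProgram 8 (storeProgram 20 reachAddress reachUpdate))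
      (by
        rintro l s₁ s₂ hm hr ⟨h1, h2⟩
        exact ⟨hm ▸ h1, fun r hr' => (hr r (Or.inl hr')).trans (h2 r hr')⟩)
      (by
        rintro i hi s₁ ⟨h1, h2⟩ h10 h15
        obtain ⟨s₂, hr, hm, hr'⟩ := inner j i hi s₁ h10 h15 h1
        refine ⟨s₂, hr, ⟨⟨hm.adj, hm.sound, hm.prev, fun u v huv => hm.next u v ?_⟩,
          fun r hr => (hr' r (by omega)).trans (h2 r hr)⟩,
          (hr' 0 (by norm_num)).trans h10, (hr' 5 (by norm_num)).trans h15, hr' 6 (by norm_num)⟩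
        have := v.2
        omega)
      (s := s) ⟨hs, fun _ _ => rfl⟩ hs0
    exact ⟨s', hr, h1, h2⟩
  obtain ⟨s', hr, ⟨h1, h2⟩, hs'0⟩ := forProgram_runs (a := 2) (by norm_num)
    (I := fun j s' => ReachInvariant G j 0 0 s'.mem ∧ s'.reg 1 = s.reg 1)
    (n := n) (T := n * (n * (T + 4) + 4 + 4) + 4)
    (c := forProgram 5 (forProgram 8 (storeProgram 20 reachAddress reachUpdate)))
    (by
      rintro l s₁ s₂ hm hr ⟨h1, h2⟩
      exact ⟨hm ▸ h1, (hr 1 (by norm_num)).trans h2⟩)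
    (by
      rintro j hj s₁ ⟨h1, h2⟩ h10 h12
      obtain ⟨s₂, hr, hm, hr'⟩ := middle j s₁ h10 h1
      refine ⟨s₂, hr, ⟨⟨hm.adj, hm.sound, fun u v huv => hm.next u v (Or.inl u.2) huv,
        fun u v huv => by omega⟩, (hr' 1 (by norm_num)).trans h2⟩,
        (hr' 0 (by norm_num)).trans h10, (hr' 2 (by norm_num)).trans h12, hr' 3 (by norm_num)⟩)
    (s := s) ⟨⟨hG, fun u v huv => absurd (h0 _ (by omega)) huv, fun u v huv => huv.elim,
      fun u v huv => by omega⟩, rfl⟩ hs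
  refine ⟨s', hr.mono ?_, hs'0, h2, h1.adj, fun u v => ⟨h1.sound u v, fun huv =>
    h1.prev u v huv.reachableWithin⟩⟩
  simp only [reachCost, Polynomial.eval_add, Polynomial.eval_mul, Polynomial.eval_X,
    Polynomial.eval_ofNat]
  exact le_of_eq (by rw [hT]; ring)

end Reachability

/-! ### The domination number as a term -/

section Gamma

open RamTerm

/-- The vertex `1` is in the component of the vertex `0`. -/
def memComponentTerm : RamTerm := reach 0 1

/-- The vertex `0` is the least vertex of its component. -/
def leastTerm : RamTerm := not (sum 1 (and memComponentTerm (sub (var 0) (var 1))))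

/-- The component of the vertex `0` has a vertex of degree at least three. -/
def branchingTerm : RamTerm :=
  sum 1 (sum 2 (sum 3 (sum 4 (and memComponentTerm (and (not (eq (var 2) (var 3)))
    (and (not (eq (var 2) (var 4))) (and (not (eq (var 3) (var 4)))
      (and (adj 1 2) (and (adj 1 3) (adj 1 4))))))))))

/-- The vertex `1` is in the completion of the tuple of the vertices `20, …, 34` in the component
of the vertex `0`. -/
def memCompletionTerm : RamTerm :=
  and memComponentTerm (or (anyBelow 15 fun i => eq (var 1) (var (20 + i)))
    (not (anyBelow 15 fun i => adj 1 (20 + i))))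

/-- The least size of the completion of a tuple. -/
def minCompletionTerm : RamTerm :=
  count 5 (not (exTuple 15 (not (sub (count 1 memCompletionTerm) (var 5)))))

/-- A third of the size of the component, rounded up. -/
def thirdTerm : RamTerm :=
  count 5 (sub (count 1 memComponentTerm) (add (var 5) (add (var 5) (var 5))))

/-- The domination number. -/
def dominationTerm : RamTerm :=
  sum 0 (ite leastTerm (ite branchingTerm minCompletionTerm thirdTerm) (const 0))

/-- This places all variables in registers below 60, where the result is computed. -/
lemma bound_dominationTerm : dominationTerm.bound ≤ 58 := by
  simp [dominationTerm, leastTerm, branchingTerm, minCompletionTerm, thirdTerm, memCompletionTerm,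
    memComponentTerm, bound, RamTerm.and, RamTerm.or, RamTerm.not, RamTerm.eq, count, anyBelow,
    exTuple, adj, reach]

variable {n : ℕ} {G : SimpleGraph (Fin n)} {μ ρ : ℕ → ℕ} {v : Fin n}

/-- The memory holds the adjacency matrix and, after it, the reachability relation. -/
structure HoldsReachability (G : SimpleGraph (Fin n)) (μ : ℕ → ℕ) : Prop where
  adj : ∀ u v : Fin n, μ (u * n + v) ≠ 0 ↔ G.Adj u v
  reach : ∀ u v : Fin n, μ (n * n + (u * n + v)) ≠ 0 ↔ G.Reachable u v

lemma holds_adj_iff (h : HoldsReachability G μ) {x y : ℕ} (hx : x ≠ 14) {u v : Fin n}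
    (hu : ρ x = u) (hv : ρ y = v) : Holds n μ (adj x y) ρ ↔ G.Adj u v := by
  rw [Holds, eval_adj hx, hu, hv, h.adj]

lemma holds_memComponentTerm (h : HoldsReachability G μ) {u : Fin n}
    (hv : ρ 0 = v) (hu : ρ 1 = u) : Holds n μ memComponentTerm ρ ↔ G.Reachable v u := by
  rw [memComponentTerm, Holds, eval_reach (by norm_num), hu, hv, h.reach]

lemma holds_leastTerm (h : HoldsReachability G μ) (hv : ρ 0 = v) :
    Holds n μ leastTerm ρ ↔ IsLeastInComponent G v := by
  rw [leastTerm, holds_not, holds_sum, not_exists]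
  refine forall_congr' fun u => ?_
  rw [holds_and, holds_memComponentTerm h (v := v) (u := u) (by simp [hv]) (by simp), holds_sub]
  rw [eval, eval, Function.update_self, Function.update_of_ne (by norm_num), hv, not_and, not_lt]
  rfl

lemma holds_branchingTerm (h : HoldsReachability G μ) (hv : ρ 0 = v) :
    Holds n μ branchingTerm ρ ↔ HasBranching G v := by
  simp only [branchingTerm, holds_sum]
  refine exists_congr fun u => exists_congr fun x₁ => exists_congr fun x₂ => exists_congr fun x₃ =>
    ?_
  rw [holds_and, holds_memComponentTerm h (v := v) (u := u) (by simp [hv]) (by simp)]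
  simp only [holds_and, holds_not, holds_eq]
  rw [holds_adj_iff h (u := u) (v := x₁) (by norm_num) (by simp) (by simp),
    holds_adj_iff h (u := u) (v := x₂) (by norm_num) (by simp) (by simp),
    holds_adj_iff h (u := u) (v := x₃) (by norm_num) (by simp) (by simp)]
  simp [eval, Fin.ext_iff]

lemma eval_count_memComponentTerm (h : HoldsReachability G μ) (hv : ρ 0 = v) :
    (count 1 memComponentTerm).eval n μ ρ = (componentOf G v).card := by
  classical
  rw [eval_count]
  congr 1
  ext u
  rw [Finset.mem_filter, mem_componentOf,
    holds_memComponentTerm h (v := v) (u := u) (by simp [hv]) (by simp)]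
  simp

lemma eval_count_memCompletionTerm (h : HoldsReachability G μ) (hv : ρ 0 = v)
    {a : Fin 15 → Fin n} (ha : ∀ i : Fin 15, ρ (20 + i) = a i) :
    (count 1 memCompletionTerm).eval n μ ρ = (componentCompletion G v a).card := by
  classical
  rw [eval_count]
  congr 1
  ext u
  rw [componentCompletion, Finset.mem_filter, Finset.mem_filter, mem_componentOf,
    memCompletionTerm, holds_and, holds_memComponentTerm h (v := v) (u := u) (by simp [hv])
      (by simp), holds_or, holds_not, holds_anyBelow, holds_anyBelow, not_exists]
  have ha' : ∀ i : Fin 15, Function.update ρ 1 u (20 + i) = a i := by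
    intro i
    rw [Function.update_of_ne (by omega), ha]
  have h1 : ∀ i : Fin 15, Holds n μ (adj 1 (20 + i)) (Function.update ρ 1 u) ↔ G.Adj u (a i) :=
    fun i => holds_adj_iff h (by norm_num) (by simp) (ha' i)
  simp only [h1, holds_eq, eval, ha']
  simp [Fin.ext_iff]

lemma card_filter_val_lt {m : ℕ} (hm : m ≤ n) :
    (Finset.univ.filter fun j : Fin n => (j : ℕ) < m).card = m := by
  simp [Fin.card_filter_val_lt, hm]

/-- A minimum is obtained by counting: the numbers `j` such that no tuple has a completion of size
at most `j` are exactly those below the minimum, and all of these are below `n`. -/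
lemma eval_minCompletionTerm (h : HoldsReachability G μ) (hv : ρ 0 = v) {a : Fin 15 → Fin n}
    (ha : ∀ b : Fin 15 → Fin n, (componentCompletion G v a).card ≤
      (componentCompletion G v b).card) :
    minCompletionTerm.eval n μ ρ = (componentCompletion G v a).card := by
  classical
  rw [minCompletionTerm, eval_count]
  rw [← card_filter_val_lt (n := n) (m := (componentCompletion G v a).card)
    ((Finset.card_le_univ _).trans (by simp))]
  congr 1
  ext j
  rw [Finset.mem_filter, Finset.mem_filter, holds_not, holds_exTuple, ← not_le]
  refine and_congr_right fun _ => not_congr ⟨?_, fun hj => ?_⟩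
  · rintro ⟨ρ', h1, h2, h3⟩
    rw [holds_not, holds_sub, not_lt, eval_count_memCompletionTerm h (v := v)
      (a := fun i => ⟨ρ' (20 + i), h2 i i.2⟩) (by rw [h1 0 (by norm_num)]; simp [hv])
      (fun i => rfl)] at h3
    refine (ha _).trans (h3.trans_eq ?_)
    rw [eval, h1 5 (by norm_num)]
    simp
  · refine ⟨fun x => if hx : 20 ≤ x ∧ x < 20 + 15 then a ⟨x - 20, by omega⟩ else
      Function.update ρ 5 j x, fun x hx => dif_neg (by omega), fun i hi => ?_, ?_⟩
    · simp [show 20 + i < 35 by omega]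
    · rw [holds_not, holds_sub, not_lt, eval_count_memCompletionTerm h (v := v) (a := a)
        (by simp [hv]) (fun i => by simp [show 20 + (i : ℕ) < 35 by omega])]
      simpa [eval] using hj

/-- The number of `j` with 3`j` < `c` is `c`/3 rounded up, which avoids division. -/
lemma eval_thirdTerm (h : HoldsReachability G μ) (hv : ρ 0 = v) :
    thirdTerm.eval n μ ρ = ((componentOf G v).card + 2) / 3 := by
  classical
  have hc : (componentOf G v).card ≤ n := (Finset.card_le_univ _).trans (by simp)
  rw [thirdTerm, eval_count]
  conv_rhs => rw [← card_filter_val_lt (n := n) (m := ((componentOf G v).card + 2) / 3) (by omega)]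
  congr 1
  ext j
  rw [Finset.mem_filter, Finset.mem_filter, holds_sub,
    eval_count_memComponentTerm h (v := v) (by simp [hv])]
  simp only [eval, Function.update_self]
  refine and_congr_right fun _ => ?_
  omega

/-- Completions dominate, so the minimum over tuples cannot fall below the domination number of a
branching component, and a core attains it. -/
theorem eval_dominationTerm (hG : G ∈ freeForkK3K2 n) (h : HoldsReachability G μ) :
    dominationTerm.eval n μ ρ = dominationNumber G := by
  classical
  set g : Fin n → ℕ := fun v =>
    (ite branchingTerm minCompletionTerm thirdTerm).eval n μ (Function.update ρ 0 v) with hg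
  rw [dominationNumber_eq_sum (g := g), dominationTerm, eval, Finset.sum_range]
  · refine Finset.sum_congr rfl fun v _ => ?_
    have hv : Function.update ρ 0 (v : ℕ) 0 = v := by simp
    rw [eval]
    exact if_congr (holds_leastTerm h hv) rfl rfl
  · intro v _
    have hv : Function.update ρ 0 (v : ℕ) 0 = v := by simp
    by_cases hb : HasBranching G v
    · obtain ⟨a, ha⟩ := exists_componentCompletion_le hG hb
      have e : g v = (componentCompletion G v a).card := by
        rw [hg]
        simp only [eval]
        rw [if_pos (show _ ≠ 0 from (holds_branchingTerm h hv).2 hb)]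
        exact eval_minCompletionTerm h hv fun b =>
          ha _ (dominatesComponent_componentCompletion v b)
      rw [e]
      exact ⟨⟨_, dominatesComponent_componentCompletion v a, le_rfl⟩, ha⟩
    · have e : g v = ((componentOf G v).card + 2) / 3 := by
        rw [hg]
        simp only [eval]
        rw [if_neg (show ¬ _ ≠ 0 from mt (holds_branchingTerm h hv).1 hb)]
        exact eval_thirdTerm h hv
      rw [e]
      exact isComponentDominationNumber_of_not_hasBranching hb

end Gamma

/-! ### The reduction

The domination number of a `{fork, K₃ + K₂}`-free graph is computed in polynomial time, component by
component: a component without vertices of degree at least three is a path or a cycle, and in any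
other component some tuple of fifteen vertices has a completion that is a minimum dominating set.
The reduction writes an instance with one vertex that has the answer so obtained. -/

/-- A program that, given the domination number in register `60` and the number `k` in register
`1`, writes the graph with one vertex and the number `(k + 1) - γ`. -/
def outputProgram : RamProgram :=
  .seq (.set 61 1) <| .seq (.add 1 1 61) <| .seq (.sub 1 1 60) <| .seq (.set 0 1) <|
    .seq (.set 61 0) (.store 61 61)

lemma outputProgram_runs (s : RamState) : ∃ s', RamRun outputProgram s s' 6 ∧ s'.reg 0 = 1 ∧
    s'.reg 1 = s.reg 1 + 1 - s.reg 60 ∧ s'.mem 0 = 0 := by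
  refine ⟨_, (RamRun.set _ _ _).seq ((RamRun.add _ _ _ _).seq ((RamRun.sub _ _ _ _).seq
    ((RamRun.set _ _ _).seq ((RamRun.set _ _ _).seq (RamRun.store _ _ _))))), ?_, ?_, ?_⟩ <;> simp

lemma dominationNumber_one (G : SimpleGraph (Fin 1)) : dominationNumber G = 1 := by
  refine le_antisymm (Nat.sInf_le ⟨Finset.univ, fun v hv => absurd (Finset.mem_univ v) hv, rfl⟩)
    (le_csInf ⟨_, Finset.univ, fun v hv => absurd (Finset.mem_univ v) hv, rfl⟩ ?_)
  rintro m ⟨D, hD, rfl⟩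
  by_contra! h
  obtain rfl : D = ∅ := Finset.card_eq_zero.1 (by omega)
  obtain ⟨u, hu, -⟩ := hD 0 (by simp)
  simp at hu

lemma mem_freeP5ForkK3K2_one (G : SimpleGraph (Fin 1)) : G ∈ freeP5ForkK3K2 1 := by
  refine ⟨?_, ?_, ?_⟩ <;>
  · rintro ⟨f⟩
    have := Fintype.card_le_of_injective f f.injective
    simp at this

lemma holdsAdjacency_inputState {n : ℕ} (G : SimpleGraph (Fin n)) (k : ℕ) :
    HoldsAdjacency G (inputState G k).mem := by
  intro u v
  simp only [inputState, ne_eq, ite_eq_right_iff, one_ne_zero, imp_false, not_not]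
  constructor
  · rintro ⟨i, j, h, hij⟩
    obtain ⟨h1, h2⟩ := mul_add_inj v.2 j.2 h
    rwa [Fin.ext h1, Fin.ext h2]
  · exact fun h => ⟨u, v, rfl, h⟩

lemma inputState_mem_eq_zero {n : ℕ} (G : SimpleGraph (Fin n)) (k : ℕ) {a : ℕ} (ha : n * n ≤ a) :
    (inputState G k).mem a = 0 := by
  simp only [inputState, ite_eq_right_iff, one_ne_zero, imp_false]
  rintro ⟨i, j, h, -⟩
  have := mul_add_lt i.2 j.2
  omega

/-- The dominating set problem for `{fork, K₃ + K₂}`-free graphs polynomially reduces to the same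
problem for `{P₅, fork, K₃ + K₂}`-free graphs. -/
theorem lemma16 : DominatingSetPolyReducible freeForkK3K2 freeP5ForkK3K2 := by
  refine ⟨.seq reachProgram (.seq (dominationTerm.compile 60) outputProgram),
    reachCost + (dominationTerm.cost + 6), fun n G hG k => ?_⟩
  obtain ⟨s₁, h1, h10, h11, hadj, hreach⟩ := reachProgram_runs (s := inputState G k) (by rfl)
    (holdsAdjacency_inputState G k) fun a ha => inputState_mem_eq_zero G k ha
  obtain ⟨s₂, h2, -, hr, hv⟩ := dominationTerm.compile_runs (d := 60)
    (Nat.add_le_add_right bound_dominationTerm 2) h10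
  obtain ⟨s₃, h3, h30, h31, h3m⟩ := outputProgram_runs s₂
  obtain ⟨t, ht, hrun⟩ := h1.seq (h2.seq h3.within)
  rw [eval_dominationTerm hG ⟨hadj, hreach⟩] at hv
  have hk : s₂.reg 1 = k := (hr 1 (by norm_num)).trans h11
  -- One vertex has domination number 1, and 1 ≤ (`k` + 1) - γ holds exactly when γ ≤ `k`, also when
  -- the subtraction is truncated.
  refine ⟨s₃, t, hrun, by simpa using ht, 1, ⊥, k + 1 - dominationNumber G, ⟨h30, ?_, ?_⟩, ?_,
    mem_freeP5ForkK3K2_one _, ?_⟩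
  · rw [h31, hk, hv]
  · intro i j
    simp [Subsingleton.elim i 0, Subsingleton.elim j 0, h3m]
  -- The constant 6 in the polynomial also bounds the single vertex of the output.
  · simp only [Polynomial.eval_add, Polynomial.eval_ofNat]
    omega
  · rw [dominationNumber_one]
    omega
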